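/- Let $k$ be an infinite field and let $\Gamma$ be an ordered abelian group of rank $1$ (that is, $\Gamma \neq 0$ and its only convex subgroups are $0$ and $\Gamma$). Let $K = k(\!(t^{\Gamma})\!)$ be the field of Hahn series $\sum_{q\in\Gamma} c_q t^q$ with coefficients $c_q \in k$ and well-ordered support, with valuation $v\colon K\to \Gamma\cup\{\infty\}$, $v(x)=\min \operatorname{supp}(x)$ for $x \neq 0$, and total residue map $$\operatorname{res}\colon K\to k,\qquad \sum_{q\in\Gamma} c_q t^q\mapsto c_0 .$$ Let $L_{\operatorname{res}}$ be the three-sorted first-order language with sorts for the field $K$, for $\Gamma\cup\{\infty\}$ and for the residue field $k$, with the language of rings on $K$ and on $k$, the symbols $0,\infty,+,<$ on $\Gamma\cup\{\infty\}$, and function symbols for $v\colon K\to\Gamma\cup\{\infty\}$ and $\operatorname{res}\colon K\to k$; it contains no constant symbol for $t$. Then the $L_{\operatorname{res}}$-structure $(K,\Gamma\cup\{\infty\},k;v,\operatorname{res})$ interprets $(\mathbb{N},+,\cdot)$ without parameters, and it is undecidable: there is no algorithm that decides, given an $L_{\operatorname{res}}$-sentence, whether it is true in this structure. The same two assertions hold,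 for every infinite field $k$, for the Puiseux series field $k\{\!\{t\}\!\}=\bigcup_{n\geq 1} k(\!(t^{1/n})\!)$, with value group $\mathbb{Q}$, residue field $k$, and the valuation $v$ and the total residue map $\operatorname{res}$ given by the same formulas. -/

import Mathlib

universe u v

/-- An ordered abelian group has rank one if it is non-trivial and its only convex subgroups
are `0` and the whole group. -/
def IsRankOne (Γ : Type v) [AddCommGroup Γ] [LinearOrder Γ] : Prop :=
  Nontrivial Γ ∧ ∀ H : AddSubgroup Γ, (H : Set Γ).OrdConnected → H = ⊥ ∨ H = ⊤

namespace LRes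

/-! ### Syntax of the three-sorted language `L_res`

The sorts are the valued field `K`, the value group with infinity `V = Γ ∪ {∞}` and the residue
field `k`. Both fields carry the language of rings, `V` carries `0, ∞, +, <`, and there are
function symbols `v : K → V` and `res : K → k`. Each sort has variables named by the natural
numbers. There is no constant for `t`. -/

/-- Terms of the field sort. -/
inductive TermK : Type
  | var : ℕ → TermK
  | zero : TermK
  | one : TermK
  | neg : TermK → TermK
  | add : TermK → TermK → TermK
  | mul : TermK → TermK → TermK

/-- Terms of the value group sort. -/
inductive TermV : Type
  | var : ℕ → TermV
  | zero : TermV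
  | infty : TermV
  | add : TermV → TermV → TermV
  | val : TermK → TermV

/-- Terms of the residue field sort. -/
inductive TermR : Type
  | var : ℕ → TermR
  | zero : TermR
  | one : TermR
  | neg : TermR → TermR
  | add : TermR → TermR → TermR
  | mul : TermR → TermR → TermR
  | res : TermK → TermR

/-- First-order formulas of `L_res`, with one existential quantifier for each sort. -/
inductive Formula : Type
  | eqK : TermK → TermK → Formula
  | eqV : TermV → TermV → Formula
  | eqR : TermR → TermR → Formula
  | ltV : TermV → TermV → Formula
  | not : Formula → Formula
  | and : Formula → Formula → Formula
  | exK : ℕ → Formula → Formula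
  | exV : ℕ → Formula → Formula
  | exR : ℕ → Formula → Formula

/-- The three sorts. -/
inductive Srt : Type
  | K
  | V
  | R

/-! ### Free variables -/

def TermK.vars : TermK → Set (Srt × ℕ)
  | .var n => {(.K, n)}
  | .zero => ∅
  | .one => ∅
  | .neg s => s.vars
  | .add s t => s.vars ∪ t.vars
  | .mul s t => s.vars ∪ t.vars

def TermV.vars : TermV → Set (Srt × ℕ)
  | .var n => {(.V, n)}
  | .zero => ∅
  | .infty => ∅
  | .add s t => s.vars ∪ t.vars
  | .val s => s.vars

def TermR.vars : TermR → Set (Srt × ℕ)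
  | .var n => {(.R, n)}
  | .zero => ∅
  | .one => ∅
  | .neg s => s.vars
  | .add s t => s.vars ∪ t.vars
  | .mul s t => s.vars ∪ t.vars
  | .res s => s.vars

def Formula.freeVars : Formula → Set (Srt × ℕ)
  | .eqK s t => s.vars ∪ t.vars
  | .eqV s t => s.vars ∪ t.vars
  | .eqR s t => s.vars ∪ t.vars
  | .ltV s t => s.vars ∪ t.vars
  | .not φ => φ.freeVars
  | .and φ ψ => φ.freeVars ∪ ψ.freeVars
  | .exK n φ => φ.freeVars \ {(.K, n)}
  | .exV n φ => φ.freeVars \ {(.V, n)}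
  | .exR n φ => φ.freeVars \ {(.R, n)}

/-- A sentence is a formula without free variables. -/
def Formula.IsSentence (φ : Formula) : Prop := φ.freeVars = ∅

/-! ### Gödel numbering -/

def TermK.code : TermK → ℕ
  | .var n => Nat.pair 0 n
  | .zero => Nat.pair 1 0
  | .one => Nat.pair 2 0
  | .neg s => Nat.pair 3 s.code
  | .add s t => Nat.pair 4 (Nat.pair s.code t.code)
  | .mul s t => Nat.pair 5 (Nat.pair s.code t.code)

def TermV.code : TermV → ℕ
  | .var n => Nat.pair 0 n
  | .zero => Nat.pair 1 0
  | .infty => Nat.pair 2 0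
  | .add s t => Nat.pair 3 (Nat.pair s.code t.code)
  | .val s => Nat.pair 4 s.code

def TermR.code : TermR → ℕ
  | .var n => Nat.pair 0 n
  | .zero => Nat.pair 1 0
  | .one => Nat.pair 2 0
  | .neg s => Nat.pair 3 s.code
  | .add s t => Nat.pair 4 (Nat.pair s.code t.code)
  | .mul s t => Nat.pair 5 (Nat.pair s.code t.code)
  | .res s => Nat.pair 6 s.code

def Formula.code : Formula → ℕ
  | .eqK s t => Nat.pair 0 (Nat.pair s.code t.code)
  | .eqV s t => Nat.pair 1 (Nat.pair s.code t.code)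
  | .eqR s t => Nat.pair 2 (Nat.pair s.code t.code)
  | .ltV s t => Nat.pair 3 (Nat.pair s.code t.code)
  | .not φ => Nat.pair 4 φ.code
  | .and φ ψ => Nat.pair 5 (Nat.pair φ.code ψ.code)
  | .exK n φ => Nat.pair 6 (Nat.pair n φ.code)
  | .exV n φ => Nat.pair 7 (Nat.pair n φ.code)
  | .exR n φ => Nat.pair 8 (Nat.pair n φ.code)

theorem TermK.code_injective : Function.Injective TermK.code := by
  intro s
  induction s with
  | var | zero | one => intro t; cases t <;> simp [TermK.code]
  | neg a iha =>
    intro t; cases t <;> simp [TermK.code]; exact fun h => iha h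
  | add a b iha ihb | mul a b iha ihb =>
    intro t; cases t <;> simp [TermK.code]; exact fun h h' => ⟨iha h, ihb h'⟩

theorem TermV.code_injective : Function.Injective TermV.code := by
  intro s
  induction s with
  | var | zero | infty => intro t; cases t <;> simp [TermV.code]
  | val a => intro t; cases t <;> simp [TermV.code]; exact fun h => TermK.code_injective h
  | add a b iha ihb =>
    intro t; cases t <;> simp [TermV.code]; exact fun h h' => ⟨iha h, ihb h'⟩

theorem TermR.code_injective : Function.Injective TermR.code := by
  intro s
  induction s with
  | var | zero | one => intro t; cases t <;> simp [TermR.code]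
  | neg a iha =>
    intro t; cases t <;> simp [TermR.code]; exact fun h => iha h
  | res a => intro t; cases t <;> simp [TermR.code]; exact fun h => TermK.code_injective h
  | add a b iha ihb | mul a b iha ihb =>
    intro t; cases t <;> simp [TermR.code]; exact fun h h' => ⟨iha h, ihb h'⟩

theorem Formula.code_injective : Function.Injective Formula.code := by
  intro s
  induction s with
  | eqK a b =>
    intro t; cases t <;> simp [Formula.code]
    exact fun h h' => ⟨TermK.code_injective h, TermK.code_injective h'⟩
  | eqV a b | ltV a b =>
    intro t; cases t <;> simp [Formula.code]
    exact fun h h' => ⟨TermV.code_injective h, TermV.code_injective h'⟩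
  | eqR a b =>
    intro t; cases t <;> simp [Formula.code]
    exact fun h h' => ⟨TermR.code_injective h, TermR.code_injective h'⟩
  | not a iha =>
    intro t; cases t <;> simp [Formula.code]; exact fun h => iha h
  | and a b iha ihb =>
    intro t; cases t <;> simp [Formula.code]; exact fun h h' => ⟨iha h, ihb h'⟩
  | exK n a iha | exV n a iha | exR n a iha =>
    intro t; cases t <;> simp [Formula.code]; exact fun h h' => ⟨h, iha h'⟩

end LRes

/-- An `L_res`-structure on the rings `K` and `k` and on `V`: the remaining symbols `v` and `res`
are interpreted by `val` and `res`, all other symbols by the operations on `K`, `V` and `k`. -/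
structure LResStructure (K V k : Type*) [Ring K] [Zero V] [Top V] [Add V] [LT V] [Ring k] where
  val : K → V
  res : K → k

namespace LResStructure

open LRes

variable {K V k : Type*} [Ring K] [Zero V] [Top V] [Add V] [LT V] [Ring k]

/-- An assignment of elements of `K`, `V` and `k` to the variables of the three sorts. -/
structure Assignment (K V k : Type*) where
  toK : ℕ → K
  toV : ℕ → V
  toR : ℕ → k

def evalK (e : Assignment K V k) : TermK → K
  | .var n => e.toK n
  | .zero => 0
  | .one => 1
  | .neg s => -evalK e s
  | .add s t => evalK e s + evalK e t
  | .mul s t => evalK e s * evalK e t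

variable (M : LResStructure K V k)

def evalV (e : Assignment K V k) : TermV → V
  | .var n => e.toV n
  | .zero => 0
  | .infty => ⊤
  | .add s t => evalV e s + evalV e t
  | .val s => M.val (evalK e s)

def evalR (e : Assignment K V k) : TermR → k
  | .var n => e.toR n
  | .zero => 0
  | .one => 1
  | .neg s => -evalR e s
  | .add s t => evalR e s + evalR e t
  | .mul s t => evalR e s * evalR e t
  | .res s => M.res (evalK e s)

/-- Tarski's satisfaction relation. -/
def Satisfies : Assignment K V k → Formula → Prop
  | e, .eqK s t => evalK e s = evalK e t
  | e, .eqV s t => M.evalV e s = M.evalV e t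
  | e, .eqR s t => M.evalR e s = M.evalR e t
  | e, .ltV s t => M.evalV e s < M.evalV e t
  | e, .not φ => ¬ Satisfies e φ
  | e, .and φ ψ => Satisfies e φ ∧ Satisfies e ψ
  | e, .exK n φ => ∃ x : K, Satisfies { e with toK := Function.update e.toK n x } φ
  | e, .exV n φ => ∃ x : V, Satisfies { e with toV := Function.update e.toV n x } φ
  | e, .exR n φ => ∃ x : k, Satisfies { e with toR := Function.update e.toR n x } φ

/-- `M` is undecidable if no algorithm decides, given (the Gödel number of) a sentence, whether
it is true in `M`. -/
def Undecidable : Prop :=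
  ¬ ComputablePred fun n : ℕ =>
    ∃ φ : Formula, φ.code = n ∧ φ.IsSentence ∧ ∀ e : Assignment K V k, M.Satisfies e φ

/-- Tuples of `p` elements of `K`, `q` elements of `V` and `r` elements of `k`. -/
abbrev Tuple (K V k : Type*) (p q r : ℕ) : Type _ := (Fin p → K) × (Fin q → V) × (Fin r → k)

/-- A set of `n`-tuples of elements of `K ^ p × V ^ q × k ^ r` is definable without parameters
if membership is expressed by a formula, in which the `i`-th coordinate, in the respective sort,
of the `j`-th tuple is the variable with the name `⟨j, i⟩`. As this has to hold for all
assignments, the truth of the formula depends on no other variables. -/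
def Definable {n p q r : ℕ} (S : Set (Fin n → Tuple K V k p q r)) : Prop :=
  ∃ φ : Formula, ∀ e : Assignment K V k, M.Satisfies e φ ↔
    (fun j : Fin n => ((fun i : Fin p => e.toK (Nat.pair j i), fun i : Fin q => e.toV (Nat.pair j i),
      fun i : Fin r => e.toR (Nat.pair j i)) : Tuple K V k p q r)) ∈ S

/-- `M` interprets the first-order structure `N` without parameters: there is a surjection `f`
onto `N` from a parameter-free definable set `X` of tuples of `M`, such that the preimages under
`f` of the equality of `N`, of the graph of every function symbol and of every relation symbol
are definable without parameters in `M`. -/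
def Interprets (L : FirstOrder.Language) (N : Type*) [L.Structure N] : Prop :=
  ∃ (p q r : ℕ) (X : Set (Tuple K V k p q r)) (f : X → N),
    Function.Surjective f ∧
    M.Definable {x : Fin 1 → Tuple K V k p q r | x 0 ∈ X} ∧
    M.Definable {x : Fin 2 → Tuple K V k p q r |
      ∃ h : ∀ j, x j ∈ X, f ⟨x 0, h 0⟩ = f ⟨x 1, h 1⟩} ∧
    (∀ (n : ℕ) (F : L.Functions n), M.Definable {x : Fin (n + 1) → Tuple K V k p q r |
      ∃ h : ∀ j, x j ∈ X, FirstOrder.Language.Structure.funMap F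
        (fun j : Fin n => f ⟨x j.castSucc, h _⟩) = f ⟨x (Fin.last n), h _⟩}) ∧
    (∀ (n : ℕ) (R : L.Relations n), M.Definable {x : Fin n → Tuple K V k p q r |
      ∃ h : ∀ j, x j ∈ X, FirstOrder.Language.Structure.RelMap R (fun j => f ⟨x j, h j⟩)})

end LResStructure

/-- The function symbols `+` and `·` of arithmetic. -/
inductive ArithFunc : ℕ → Type
  | add : ArithFunc 2
  | mul : ArithFunc 2

/-- The language of arithmetic, with the two binary function symbols `+` and `·`. -/
def arithLanguage : FirstOrder.Language where
  Functions := ArithFunc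
  Relations := fun _ => Empty

/-- The structure `(ℕ, +, ·)`. -/
instance arithStructure : arithLanguage.Structure ℕ where
  funMap := fun {_} F x =>
    match F, x with
    | .add, x => x 0 + x 1
    | .mul, x => x 0 * x 1
  RelMap := fun {_} R _ => nomatch R

noncomputable section

/-- The Hahn series field `k((t^Γ))` with its valuation `v_t` and its total residue map, which
picks out the coefficient of `t ^ 0`. -/
def hahnRes (k : Type u) (Γ : Type v) [Field k] [AddCommGroup Γ] [LinearOrder Γ]
    [IsOrderedAddMonoid Γ] : LResStructure (HahnSeries Γ k) (WithTop Γ) k where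
  val := HahnSeries.addVal Γ k
  res x := x.coeff 0

/-- The order embedding `ℤ → ℚ`, `z ↦ z / n`, of groups. -/
def intDiv (n : ℕ+) : ℤ →+ ℚ where
  toFun z := (z : ℚ) / (n : ℕ)
  map_zero' := by simp
  map_add' a b := by push_cast; ring

theorem intDiv_le_iff (n : ℕ+) (a b : ℤ) : intDiv n a ≤ intDiv n b ↔ a ≤ b := by
  have hn : (0 : ℚ) < (n : ℕ) := by exact_mod_cast n.pos
  change (a : ℚ) / (n : ℕ) ≤ (b : ℚ) / (n : ℕ) ↔ a ≤ b
  rw [div_le_div_iff_of_pos_right hn]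
  exact Int.cast_le

theorem intDiv_injective (n : ℕ+) : Function.Injective (intDiv n) := fun a b h =>
  le_antisymm ((intDiv_le_iff n a b).1 h.le) ((intDiv_le_iff n b a).1 h.ge)

/-- The embedding of `k((t))` into `k((t^ℚ))` given by `t ↦ t ^ (1 / n)`. -/
def laurentRoot (k : Type u) [Field k] (n : ℕ+) : HahnSeries ℤ k →+* HahnSeries ℚ k :=
  HahnSeries.embDomainRingHom (intDiv n) (intDiv_injective n) (intDiv_le_iff n)

theorem laurentRoot_range_le (k : Type u) [Field k] (n m : ℕ+) :
    (laurentRoot k n).fieldRange ≤ (laurentRoot k (n * m)).fieldRange := by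
  have hn : ((n : ℕ) : ℚ) ≠ 0 := by exact_mod_cast n.ne_zero
  have hm : ((m : ℕ) : ℚ) ≠ 0 := by exact_mod_cast m.ne_zero
  have hm' : (0 : ℤ) < (m : ℕ) := by exact_mod_cast m.pos
  rintro _ ⟨x, rfl⟩
  let g : ℤ ↪o ℤ := OrderEmbedding.ofMapLEIff (fun z => z * (m : ℕ))
    (fun a b => mul_le_mul_iff_left₀ hm')
  refine ⟨HahnSeries.embDomain g x, ?_⟩
  have key : ∀ z : ℤ, intDiv n z = intDiv (n * m) (g z) := by
    intro z
    change (z : ℚ) / (n : ℕ) = ((z * (m : ℕ) : ℤ) : ℚ) / ((n * m : ℕ+) : ℕ)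
    push_cast
    field_simp
  ext q
  change (HahnSeries.embDomain _ (HahnSeries.embDomain g x)).coeff q =
    (HahnSeries.embDomain _ x).coeff q
  by_cases hq : q ∈ Set.range (intDiv n)
  · obtain ⟨z, rfl⟩ := hq
    have h2 := HahnSeries.embDomain_coeff (f := (⟨⟨intDiv n, intDiv_injective n⟩,
      intDiv_le_iff n _ _⟩ : ℤ ↪o ℚ)) (x := x) (a := z)
    refine Eq.trans ?_ h2.symm
    rw [key z]
    have h1 := HahnSeries.embDomain_coeff (f := (⟨⟨intDiv (n * m), intDiv_injective _⟩,
      intDiv_le_iff (n * m) _ _⟩ : ℤ ↪o ℚ)) (x := HahnSeries.embDomain g x) (a := g z)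
    exact h1.trans HahnSeries.embDomain_coeff
  · refine Eq.trans ?_ (HahnSeries.embDomain_of_notMem_range hq).symm
    by_cases hq' : q ∈ Set.range (intDiv (n * m))
    · obtain ⟨z, rfl⟩ := hq'
      have h1 := HahnSeries.embDomain_coeff (f := (⟨⟨intDiv (n * m), intDiv_injective _⟩,
        intDiv_le_iff (n * m) _ _⟩ : ℤ ↪o ℚ)) (x := HahnSeries.embDomain g x) (a := z)
      refine h1.trans (HahnSeries.embDomain_of_notMem_range ?_)
      rintro ⟨w, rfl⟩
      exact hq ⟨w, key w⟩
    · exact HahnSeries.embDomain_of_notMem_range hq'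

/-- The Puiseux series field `k{{t}}`, the union over `n ≥ 1` of the fields `k((t^(1/n)))`
inside `k((t^ℚ))`. -/
def puiseux (k : Type u) [Field k] : Subfield (HahnSeries ℚ k) where
  carrier := ⋃ n : ℕ+, ((laurentRoot k n).fieldRange : Set (HahnSeries ℚ k))
  zero_mem' := Set.mem_iUnion.2 ⟨1, zero_mem _⟩
  one_mem' := Set.mem_iUnion.2 ⟨1, one_mem _⟩
  neg_mem' := fun hx => by
    obtain ⟨n, hx⟩ := Set.mem_iUnion.1 hx
    exact Set.mem_iUnion.2 ⟨n, neg_mem hx⟩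
  inv_mem' := fun _ hx => by
    obtain ⟨n, hx⟩ := Set.mem_iUnion.1 hx
    exact Set.mem_iUnion.2 ⟨n, inv_mem hx⟩
  add_mem' := fun hx hy => by
    obtain ⟨n, hx⟩ := Set.mem_iUnion.1 hx
    obtain ⟨m, hy⟩ := Set.mem_iUnion.1 hy
    exact Set.mem_iUnion.2 ⟨n * m, add_mem (laurentRoot_range_le k n m hx)
      (mul_comm m n ▸ laurentRoot_range_le k m n hy)⟩
  mul_mem' := fun hx hy => by
    obtain ⟨n, hx⟩ := Set.mem_iUnion.1 hx
    obtain ⟨m, hy⟩ := Set.mem_iUnion.1 hy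
    exact Set.mem_iUnion.2 ⟨n * m, mul_mem (laurentRoot_range_le k n m hx)
      (mul_comm m n ▸ laurentRoot_range_le k m n hy)⟩

/-- The Puiseux series field with its valuation `v_t` and its total residue map. -/
def puiseuxRes (k : Type u) [Field k] : LResStructure (puiseux k) (WithTop ℚ) k where
  val x := HahnSeries.addVal ℚ k (x : HahnSeries ℚ k)
  res x := (x : HahnSeries ℚ k).coeff 0

end

/-!
A pair `(t, y)` with `v t > 0` codes the polynomial `∑ res (y * t ^ n) * X ^ n` over `k`; rank one
makes the sum finite, and for every such `t` each polynomial has a code, so that no constant for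
`t` is needed. By the geometric series, the value of this polynomial at `c ∈ k` is
`res (y * (1 - c * t)⁻¹)`. The constants `c` need not be definable: any `a` for which `res` is
`a`-linear can take the place of its residue `c`. As `k` is infinite, polynomial identities can be
checked pointwise, so that the ring `k[X]` is interpreted together with `X`.

In `k[X]`, the powers of `X` are the polynomials `P` with `P(1) = 1` all of whose non-unit divisors
are divisible by `X`. Under `n ↦ X ^ n`, multiplication becomes addition of exponents, and
`X ^ n - 1 ∣ X ^ m - 1` if and only if `n ∣ m`; by a theorem of Robinson, addition and divisibility
define the multiplication of natural numbers. Undecidability follows since the halting problem is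
arithmetical.
-/

/-! ### First-order closed families of relations -/

/-- A choice, for every `n`, of some of the `n`-ary relations on `A`. It stands for a notion of
parameter-free definability. -/
abbrev RelFamily (A : Type*) := ∀ n : ℕ, ((Fin n → A) → Prop) → Prop

/-- A family of relations that contains equality and is closed under the first-order operations.
In `ex`, the quantified variable is the first coordinate. -/
structure FirstOrderClosed {A : Type*} (D : RelFamily A) : Prop where
  eq : ∀ {n} (i j : Fin n), D n fun x => x i = x j
  not : ∀ {n} {R : (Fin n → A) → Prop}, D n R → D n fun x => ¬ R x
  and : ∀ {n} {R S : (Fin n → A) → Prop}, D n R → D n S → D n fun x => R x ∧ S x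
  ex : ∀ {n} {R : (Fin n → A) → A → Prop},
    D (n + 1) (fun y => R (fun i => y i.succ) (y 0)) → D n fun x => ∃ a, R x a
  reindex : ∀ {n m} {R : (Fin n → A) → Prop} (σ : Fin n → Fin m),
    D n R → D m fun x => R fun i => x (σ i)

/-- The graph of `f` belongs to the family `D`; the first coordinate is the value. -/
def DefinableFun {A : Type*} (D : RelFamily A) {n : ℕ} (f : (Fin n → A) → A) : Prop :=
  D (n + 1) fun y => y 0 = f fun i => y i.succ

theorem RelFamily.congr {A : Type*} {D : RelFamily A} {n : ℕ} {R S : (Fin n → A) → Prop}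
    (hR : D n R) (hRS : ∀ x, R x ↔ S x) : D n S :=
  (funext fun x => propext (hRS x) : R = S) ▸ hR

namespace FirstOrderClosed

variable {A : Type*} {D : RelFamily A} (h : FirstOrderClosed D)

include h

theorem or {n : ℕ} {R S : (Fin n → A) → Prop} (hR : D n R) (hS : D n S) :
    D n fun x => R x ∨ S x :=
  RelFamily.congr (h.not (h.and (h.not hR) (h.not hS))) fun _ => by tauto

theorem imp {n : ℕ} {R S : (Fin n → A) → Prop} (hR : D n R) (hS : D n S) :
    D n fun x => R x → S x :=
  RelFamily.congr (h.or (h.not hR) hS) fun _ => by tauto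

theorem iff {n : ℕ} {R S : (Fin n → A) → Prop} (hR : D n R) (hS : D n S) :
    D n fun x => (R x ↔ S x) :=
  RelFamily.congr (h.and (h.imp hR hS) (h.imp hS hR)) fun _ => by tauto

theorem all {n : ℕ} {R : (Fin n → A) → A → Prop}
    (hR : D (n + 1) (fun y => R (fun i => y i.succ) (y 0))) : D n fun x => ∀ a, R x a :=
  RelFamily.congr (h.not (h.ex (R := fun x a => ¬ R x a) (h.not hR))) fun _ => by simp

theorem true {n : ℕ} : D n fun _ => True :=
  RelFamily.congr (h.all (R := fun _ a => a = a) (h.eq 0 0)) fun _ => by simp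

theorem forall_fin {n m : ℕ} {R : Fin m → (Fin n → A) → Prop} (hR : ∀ i, D n (R i)) :
    D n fun x => ∀ i, R i x := by
  induction m with
  | zero => exact RelFamily.congr h.true fun _ => by simp
  | succ m ih =>
    exact RelFamily.congr (h.and (hR 0) (ih fun i => hR i.succ)) fun x =>
      (Fin.forall_fin_succ (P := fun i => R i x)).symm

theorem exists_tuple {n m : ℕ} {R : (Fin n → A) → (Fin m → A) → Prop}
    (hR : D (n + m) fun y => R (fun i => y (Fin.castAdd m i)) fun i => y (Fin.natAdd n i)) :
    D n fun x => ∃ a, R x a := by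
  induction m with
  | zero =>
    exact RelFamily.congr hR fun x => by rw [Unique.exists_iff, Subsingleton.elim default]; rfl
  | succ m ih =>
    let σ : Fin (n + m + 1) → Fin (n + m + 1) := Fin.snoc Fin.succ 0
    refine RelFamily.congr (ih (R := fun x a => ∃ c, R x (Fin.snoc a c))
      (h.ex (RelFamily.congr (h.reindex σ hR) fun y => ?_))) fun x => ?_
    · have hlast : σ (Fin.natAdd n (Fin.last m)) = 0 := Fin.snoc_last _ _
      have hcast (i : Fin (n + m)) : σ i.castSucc = i.succ := Fin.snoc_castSucc ..
      refine iff_of_eq (congrArg₂ R (funext fun i => ?_) (funext fun i => ?_))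
      · exact congrArg y (hcast (Fin.castAdd m i))
      · induction i using Fin.lastCases with
        | last => exact (congrArg y hlast).trans (by rw [Fin.snoc_last])
        | cast i => exact (congrArg y (hcast (Fin.natAdd n i))).trans (by rw [Fin.snoc_castSucc])
    · exact ⟨fun ⟨_, _, hR⟩ => ⟨_, hR⟩, fun ⟨a, ha⟩ =>
        ⟨Fin.init a, a (Fin.last m), by rwa [Fin.snoc_init_self]⟩⟩

theorem comp {n m : ℕ} {R : (Fin m → A) → Prop} {f : Fin m → (Fin n → A) → A} (hR : D m R)
    (hf : ∀ i, DefinableFun D (f i)) : D n fun x => R fun i => f i x :=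
  RelFamily.congr
    (h.exists_tuple (R := fun x a => (∀ i, a i = f i x) ∧ R a)
      (h.and (h.forall_fin fun i => h.reindex (Fin.cons (Fin.natAdd n i) (Fin.castAdd m)) (hf i))
        (h.reindex (Fin.natAdd n) hR)))
    fun x => by simp only [← funext_iff, exists_eq_left]

theorem comp₂ {n : ℕ} {Q : A → A → Prop} {f g : (Fin n → A) → A}
    (hQ : D 2 fun x => Q (x 0) (x 1)) (hf : DefinableFun D f) (hg : DefinableFun D g) :
    D n fun x => Q (f x) (g x) :=
  h.comp (f := ![f, g]) hQ (Fin.forall_fin_two.2 ⟨hf, hg⟩)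

theorem comp₃ {n : ℕ} {Q : A → A → A → Prop} {f g u : (Fin n → A) → A}
    (hQ : D 3 fun x => Q (x 0) (x 1) (x 2)) (hf : DefinableFun D f) (hg : DefinableFun D g)
    (hu : DefinableFun D u) : D n fun x => Q (f x) (g x) (u x) :=
  h.comp (f := ![f, g, u]) hQ
    (Fin.forall_fin_succ.2 ⟨hf, Fin.forall_fin_two.2 ⟨hg, hu⟩⟩)

theorem var {n : ℕ} (i : Fin n) : DefinableFun D fun x => x i :=
  h.eq 0 i.succ

theorem const {a : A} (ha : D 1 fun x => x 0 = a) {n : ℕ} :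
    DefinableFun D fun _ : Fin n → A => a :=
  h.reindex (fun _ => 0) ha

theorem weaken {n : ℕ} {f : (Fin n → A) → A} (hf : DefinableFun D f) :
    DefinableFun D fun x : Fin (n + 1) → A => f fun i => x i.succ :=
  h.reindex (m := n + 2) (Fin.cons 0 fun i => i.succ.succ) hf

theorem fun_eq {n : ℕ} {f g : (Fin n → A) → A} (hf : DefinableFun D f) (hg : DefinableFun D g) :
    D n fun x => f x = g x :=
  h.comp₂ (h.eq 0 1) hf hg

theorem fun_comp₁ {n : ℕ} {F : A → A} {f : (Fin n → A) → A}
    (hF : D 2 fun x => x 0 = F (x 1)) (hf : DefinableFun D f) :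
    DefinableFun D fun x => F (f x) :=
  h.comp₂ (Q := fun a b => a = F b) hF (h.var 0) (h.weaken hf)

theorem fun_comp₂ {n : ℕ} {F : A → A → A} {f g : (Fin n → A) → A}
    (hF : D 3 fun x => x 0 = F (x 1) (x 2)) (hf : DefinableFun D f) (hg : DefinableFun D g) :
    DefinableFun D fun x => F (f x) (g x) :=
  h.comp₃ (Q := fun a b c => a = F b c) hF (h.var 0) (h.weaken hf) (h.weaken hg)

end FirstOrderClosed

/-- A first-order closed family of relations on a semiring that contains the graphs of addition
and multiplication. -/
structure SemiringClosed {A : Type*} [Semiring A] (D : RelFamily A) : Prop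
    extends FirstOrderClosed D where
  add : D 3 fun x => x 0 = x 1 + x 2
  mul : D 3 fun x => x 0 = x 1 * x 2

namespace SemiringClosed

section Semiring

variable {A : Type*} [Semiring A] {D : RelFamily A} (h : SemiringClosed D) {n : ℕ}
  {f g : (Fin n → A) → A}

include h

theorem fun_add (hf : DefinableFun D f) (hg : DefinableFun D g) :
    DefinableFun D fun x => f x + g x :=
  h.fun_comp₂ h.add hf hg

theorem fun_mul (hf : DefinableFun D f) (hg : DefinableFun D g) :
    DefinableFun D fun x => f x * g x :=
  h.fun_comp₂ h.mul hf hg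

theorem fun_zero : DefinableFun D fun _ : Fin n → A => 0 :=
  h.const <| RelFamily.congr
    (h.all (R := fun x a => x 0 + a = a) (h.fun_eq (h.fun_add (h.var _) (h.var _)) (h.var _)))
    fun _ => ⟨fun hx => by simpa using hx 0, fun hx a => by rw [hx, zero_add]⟩

theorem fun_one : DefinableFun D fun _ : Fin n → A => 1 :=
  h.const <| RelFamily.congr
    (h.all (R := fun x a => x 0 * a = a) (h.fun_eq (h.fun_mul (h.var _) (h.var _)) (h.var _)))
    fun _ => ⟨fun hx => by simpa using hx 1, fun hx a => by rw [hx, one_mul]⟩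

theorem fun_dvd (hf : DefinableFun D f) (hg : DefinableFun D g) : D n fun x => f x ∣ g x :=
  h.ex (R := fun x c => g x = f x * c)
    (h.fun_eq (h.weaken hg) (h.fun_mul (h.weaken hf) (h.var 0)))

end Semiring

theorem fun_sub {A : Type*} [Ring A] {D : RelFamily A} (h : SemiringClosed D) {n : ℕ}
    {f g : (Fin n → A) → A} (hf : DefinableFun D f) (hg : DefinableFun D g) :
    DefinableFun D fun x => f x - g x :=
  h.fun_comp₂ (RelFamily.congr (h.reindex ![1, 0, 2] h.add) fun _ =>
    eq_comm.trans eq_sub_iff_add_eq.symm) hf hg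

theorem fun_inv {A : Type*} [DivisionRing A] {D : RelFamily A} (h : SemiringClosed D) {n : ℕ}
    {f : (Fin n → A) → A} (hf : DefinableFun D f) : DefinableFun D fun x => (f x)⁻¹ := by
  refine h.fun_comp₁ (RelFamily.congr (h.or
    (h.fun_eq (h.fun_mul (h.var 0) (h.var 1)) h.fun_one)
    (h.and (h.fun_eq (h.var 1) h.fun_zero) (h.fun_eq (h.var 0) h.fun_zero))) fun x => ?_) hf
  constructor
  · rintro (hx | ⟨h1, h0⟩)
    · exact eq_inv_of_mul_eq_one_left hx
    · rw [h0, h1, inv_zero]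
  · intro hx
    by_cases h1 : x 1 = 0
    · exact Or.inr ⟨h1, by rw [hx, h1, inv_zero]⟩
    · exact Or.inl (by rw [hx, inv_mul_cancel₀ h1])

end SemiringClosed

/-! ### Codings -/

namespace RelFamily

/-- The relations on `B` that belong to `D` when the elements of `B` are given by codes; `C a b`
means that `a` is a code of `b`. -/
def coded {A B : Type*} (D : RelFamily A) (C : A → B → Prop) : RelFamily B := fun n R =>
  D n fun x => ∃ b : Fin n → B, (∀ i, C (x i) (b i)) ∧ R b

/-- The relations on pairs of elements of `A` that belong to `D` as relations between the
components. The maps `σ` and `τ` place the components of the `i`-th pair among the coordinates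
of a tuple. -/
def pairs {A : Type*} (D : RelFamily A) : RelFamily (A × A) := fun n R =>
  ∀ (m : ℕ) (σ τ : Fin n → Fin m), D m fun x => R fun i => (x (σ i), x (τ i))

theorem coded_coded {A B B' : Type*} (D : RelFamily A) (C : A → B → Prop) (C' : B → B' → Prop) :
    (D.coded C).coded C' = D.coded (Relation.Comp C C') := by
  funext n R
  refine congrArg (D n) (funext fun x => propext ⟨?_, ?_⟩)
  · rintro ⟨b, hb, b', hb', hR⟩
    exact ⟨b', fun i => ⟨b i, hb i, hb' i⟩, hR⟩
  · rintro ⟨b', hb', hR⟩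
    choose b hb hb' using hb'
    exact ⟨b, hb, b', hb', hR⟩

end RelFamily

/-- `C` is a coding of `B` in `A` that belongs to `D`: every element of `B` has a code, codes
determine the coded elements, and the set of codes is in `D`. The coded relations themselves are
treated by `RelFamily.coded`. -/
structure IsCoding {A B : Type*} (D : RelFamily A) (C : A → B → Prop) : Prop where
  rightUnique : Relator.RightUnique C
  rightTotal : Relator.RightTotal C
  dom : D 1 fun x => ∃ b, C (x 0) b

theorem IsCoding.comp {A B B' : Type*} {D : RelFamily A} {C : A → B → Prop} {C' : B → B' → Prop}
    (hC : IsCoding D C) (hC' : IsCoding (D.coded C) C') : IsCoding D (Relation.Comp C C') where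
  rightUnique := by
    rintro a b' c' ⟨b, hb, hb'⟩ ⟨c, hc, hc'⟩
    obtain rfl := hC.rightUnique hb hc
    exact hC'.rightUnique hb' hc'
  rightTotal b' :=
    have ⟨b, hb⟩ := hC'.rightTotal b'
    have ⟨a, ha⟩ := hC.rightTotal b
    ⟨a, b, ha, hb⟩
  dom := RelFamily.congr hC'.dom fun _ =>
    ⟨fun ⟨b, hb, b', hb'⟩ => ⟨b', b 0, hb 0, hb'⟩,
      fun ⟨b', b, hb, hb'⟩ => ⟨fun _ => b, fun i => by rwa [Subsingleton.elim i 0], b', hb'⟩⟩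

namespace FirstOrderClosed

variable {A B : Type*} {D : RelFamily A} (h : FirstOrderClosed D)

include h

theorem pairs : FirstOrderClosed D.pairs where
  eq i j m σ τ := RelFamily.congr (h.and (h.eq (σ i) (σ j)) (h.eq (τ i) (τ j))) fun _ =>
    Prod.mk_inj.symm
  not hR m σ τ := h.not (hR m σ τ)
  and hR hS m σ τ := h.and (hR m σ τ) (hS m σ τ)
  ex {n R} hR m σ τ := by
    refine RelFamily.congr (h.ex (R := fun x a => ∃ a', R (fun i => (x (σ i), x (τ i))) (a, a'))
      (h.ex ?_)) fun _ => Prod.exists.symm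
    exact hR (m + 2) (Fin.cons 1 fun i => (σ i).succ.succ) (Fin.cons 0 fun i => (τ i).succ.succ)
  reindex ρ hR m σ τ := hR m (fun i => σ (ρ i)) fun i => τ (ρ i)

variable {C : A → B → Prop} (hC : IsCoding D C)

include hC

theorem coded_of {n : ℕ} {R : (Fin n → B) → Prop} {S : (Fin n → A) → Prop} (hS : D n S)
    (hRS : ∀ a b, (∀ i, C (a i) (b i)) → (R b ↔ S a)) : D.coded C n R := by
  refine RelFamily.congr (D := D)
    (h.and (h.forall_fin fun i => h.reindex (fun _ => i) hC.dom) hS) fun x => ?_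
  constructor
  · rintro ⟨hb, hSx⟩
    choose b hb using hb
    exact ⟨b, hb, (hRS x b hb).2 hSx⟩
  · rintro ⟨b, hb, hRb⟩
    exact ⟨fun i => ⟨b i, hb i⟩, (hRS x b hb).1 hRb⟩

theorem coded (heq : D.coded C 2 fun b => b 0 = b 1) : FirstOrderClosed (D.coded C) := by
  have unique {n : ℕ} {a : Fin n → A} {b c : Fin n → B} (hb : ∀ i, C (a i) (b i))
      (hc : ∀ i, C (a i) (c i)) : b = c := funext fun i => hC.rightUnique (hb i) (hc i)
  have rel_iff {n : ℕ} {R : (Fin n → B) → Prop} {a : Fin n → A}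
      {b : Fin n → B} (hb : ∀ i, C (a i) (b i)) :
      R b ↔ ∃ c : Fin n → B, (∀ i, C (a i) (c i)) ∧ R c :=
    ⟨fun hR => ⟨b, hb, hR⟩, fun ⟨c, hc, hR⟩ => unique hb hc ▸ hR⟩
  have reindex {n m : ℕ} {R : (Fin n → B) → Prop} (σ : Fin n → Fin m) (hR : D.coded C n R) :
      D.coded C m fun b => R fun i => b (σ i) :=
    h.coded_of hC (h.reindex σ hR) fun a b hb => rel_iff fun i => hb (σ i)
  refine ⟨fun i j => reindex ![i, j] heq, fun hR => ?_, fun hR hS => ?_, fun {n R} hR => ?_,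
    reindex⟩
  · exact h.coded_of hC (h.not hR) fun a b hb => not_congr (rel_iff hb)
  · exact h.coded_of hC (h.and hR hS) fun a b hb => and_congr (rel_iff hb) (rel_iff hb)
  · refine h.coded_of hC (h.ex (R := fun x a => ∃ b : Fin (n + 1) → B,
      (∀ i : Fin (n + 1), C ((Fin.cons a x : Fin (n + 1) → A) i) (b i)) ∧
        R (fun i => b i.succ) (b 0)) ?_) fun a b hb => ?_
    · exact RelFamily.congr (D := D) hR fun x => by
        simp only [Fin.forall_fin_succ, Fin.cons_zero, Fin.cons_succ]
    constructor
    · rintro ⟨c, hc⟩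
      obtain ⟨a', ha'⟩ := hC.rightTotal c
      exact ⟨a', Fin.cons c b, Fin.forall_fin_succ.2 ⟨ha', hb⟩, hc⟩
    · rintro ⟨a', c, hc, hR⟩
      rw [unique hb fun i => hc i.succ]
      exact ⟨c 0, hR⟩

end FirstOrderClosed

/-! ### Arithmetical relations -/

namespace SemiringClosed

variable {D : RelFamily ℕ} (h : SemiringClosed D) {n : ℕ} {f g : (Fin n → ℕ) → ℕ}

include h

theorem fun_lt (hf : DefinableFun D f) (hg : DefinableFun D g) : D n fun x => f x < g x :=
  RelFamily.congr (h.ex (R := fun x a => g x = f x + a + 1)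
    (h.fun_eq (h.weaken hg) (h.fun_add (h.fun_add (h.weaken hf) (h.var 0)) h.fun_one)))
    fun x => ⟨fun ⟨a, ha⟩ => by lia, fun hx => ⟨g x - f x - 1, by lia⟩⟩

theorem fun_pair (hf : DefinableFun D f) (hg : DefinableFun D g) :
    DefinableFun D fun x => Nat.pair (f x) (g x) := by
  refine h.fun_comp₂ (RelFamily.congr
    (h.or (h.and (h.fun_lt (h.var 1) (h.var 2)) (h.fun_eq (h.var 0)
        (h.fun_add (h.fun_mul (h.var 2) (h.var 2)) (h.var 1))))
      (h.and (h.not (h.fun_lt (h.var 1) (h.var 2))) (h.fun_eq (h.var 0)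
        (h.fun_add (h.fun_add (h.fun_mul (h.var 1) (h.var 1)) (h.var 1)) (h.var 2)))))
    fun x => ?_) hf hg
  rw [Nat.pair]
  split_ifs with hlt <;> simp [hlt]

theorem fun_unpair_fst (hf : DefinableFun D f) : DefinableFun D fun x => (f x).unpair.1 := by
  refine h.fun_comp₁ (F := fun a => a.unpair.1) (RelFamily.congr
    (h.ex (R := fun x a => x 1 = Nat.pair (x 0) a)
      (h.fun_eq (h.var _) (h.fun_pair (h.var _) (h.var _)))) fun x => ?_) hf
  exact ⟨fun ⟨a, ha⟩ => by rw [ha, Nat.unpair_pair], fun hx => ⟨_, by rw [hx, Nat.pair_unpair]⟩⟩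

theorem fun_unpair_snd (hf : DefinableFun D f) : DefinableFun D fun x => (f x).unpair.2 := by
  refine h.fun_comp₁ (F := fun a => a.unpair.2) (RelFamily.congr
    (h.ex (R := fun x a => x 1 = Nat.pair a (x 0))
      (h.fun_eq (h.var _) (h.fun_pair (h.var _) (h.var _)))) fun x => ?_) hf
  exact ⟨fun ⟨a, ha⟩ => by rw [ha, Nat.unpair_pair], fun hx => ⟨_, by rw [hx, Nat.pair_unpair]⟩⟩

theorem fun_mod_succ (hf : DefinableFun D f) (hg : DefinableFun D g) :
    DefinableFun D fun x => f x % (g x + 1) := by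
  refine h.fun_comp₂ (F := fun a b => a % (b + 1)) (RelFamily.congr
    (h.and (h.fun_lt (h.var 0) (h.fun_add (h.var 2) h.fun_one))
      (h.ex (R := fun x a => x 1 = x 0 + (x 2 + 1) * a) (h.fun_eq (h.var _)
        (h.fun_add (h.var _) (h.fun_mul (h.fun_add (h.var _) h.fun_one) (h.var _))))))
    fun x => ?_) hf hg
  constructor
  · rintro ⟨hlt, a, ha⟩
    rw [ha, Nat.add_mul_mod_self_left, Nat.mod_eq_of_lt hlt]
  · intro hx
    rw [hx]
    exact ⟨Nat.mod_lt _ (Nat.succ_pos _), x 1 / (x 2 + 1), (Nat.mod_add_div _ _).symm⟩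

theorem fun_beta (hf : DefinableFun D f) (hg : DefinableFun D g) :
    DefinableFun D fun x => Nat.beta (f x) (g x) :=
  h.fun_mod_succ (h.fun_unpair_fst hf) (h.fun_mul (h.fun_add hg h.fun_one) (h.fun_unpair_snd hf))

end SemiringClosed

theorem exists_beta_eq (a : ℕ → ℕ) (n : ℕ) : ∃ s, ∀ i < n, Nat.beta s i = a i :=
  ⟨Nat.unbeta (List.ofFn fun i : Fin n => a i), fun i hi => by
    simpa using Nat.beta_unbeta_coe (List.ofFn fun i : Fin n => a i) ⟨i, by simpa using hi⟩⟩

theorem mem_rec_iff_exists_seq {α : Type*} (p : Part α) (q : ℕ → α → Part α) (n : ℕ) (z : α) :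
    z ∈ (n.rec p fun y IH => IH.bind (q y) : Part α) ↔
      ∃ u : ℕ → α, u 0 ∈ p ∧ (∀ y < n, u (y + 1) ∈ q y (u y)) ∧ z = u n := by
  constructor
  · intro hz
    induction n generalizing z with
    | zero => exact ⟨fun _ => z, hz, by simp, rfl⟩
    | succ n ih =>
      obtain ⟨w, hw, hz⟩ := Part.mem_bind_iff.1 hz
      obtain ⟨u, h0, hs, rfl⟩ := ih w hw
      refine ⟨fun i => if i ≤ n then u i else z, by simpa using h0, fun y hy => ?_, by simp⟩
      rcases Nat.lt_succ_iff_lt_or_eq.1 hy with hy | rfl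
      · simpa [hy.le, Nat.succ_le_of_lt hy] using hs y hy
      · simpa using hz
  · rintro ⟨u, h0, hs, rfl⟩
    induction n with
    | zero => exact h0
    | succ n ih =>
      exact Part.mem_bind_iff.2 ⟨_, ih fun y hy => hs y (by lia), hs n (by lia)⟩

theorem mem_rec_iff_exists_beta (p : Part ℕ) (q : ℕ → ℕ → Part ℕ) (n z : ℕ) :
    z ∈ (n.rec p fun y IH => IH.bind (q y) : Part ℕ) ↔
      ∃ s, Nat.beta s 0 ∈ p ∧ (∀ y < n, Nat.beta s (y + 1) ∈ q y (Nat.beta s y)) ∧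
        z = Nat.beta s n := by
  rw [mem_rec_iff_exists_seq]
  constructor
  · rintro ⟨u, h0, hs, rfl⟩
    obtain ⟨s, hβ⟩ := exists_beta_eq u (n + 1)
    refine ⟨s, ?_, fun y hy => ?_, (hβ n (by lia)).symm⟩
    · rwa [hβ 0 (by lia)]
    · rw [hβ (y + 1) (by lia), hβ y (by lia)]
      exact hs y hy
  · rintro ⟨s, hs⟩
    exact ⟨Nat.beta s, hs⟩

namespace SemiringClosed

theorem fun_mem {D : RelFamily ℕ} (h : SemiringClosed D) {p : ℕ →. ℕ}
    (hp : D 2 fun x => x 0 ∈ p (x 1)) {n : ℕ} {f g : (Fin n → ℕ) → ℕ} (hf : DefinableFun D f)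
    (hg : DefinableFun D g) : D n fun x => f x ∈ p (g x) :=
  h.comp₂ (Q := fun a b => a ∈ p b) hp hf hg

theorem mem_prec {D : RelFamily ℕ} (h : SemiringClosed D) {p q : ℕ →. ℕ}
    (hp : D 2 fun x => x 0 ∈ p (x 1)) (hq : D 2 fun x => x 0 ∈ q (x 1)) :
    D 2 fun x => x 0 ∈ (Nat.rec (p (x 1).unpair.1) (fun y IH =>
      IH.bind fun i => q (Nat.pair (x 1).unpair.1 (Nat.pair y i))) (x 1).unpair.2 : Part ℕ) := by
  refine RelFamily.congr (h.ex (R := fun x s => Nat.beta s 0 ∈ p (x 1).unpair.1 ∧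
      (∀ y, y < (x 1).unpair.2 → Nat.beta s (y + 1) ∈
        q (Nat.pair (x 1).unpair.1 (Nat.pair y (Nat.beta s y)))) ∧
      x 0 = Nat.beta s (x 1).unpair.2)
    (h.and ?_ (h.and (h.all (h.imp ?_ ?_)) ?_)))
    fun x => (mem_rec_iff_exists_beta (p (x 1).unpair.1)
      (fun y i => q (Nat.pair (x 1).unpair.1 (Nat.pair y i))) (x 1).unpair.2 (x 0)).symm
  · exact h.fun_mem hp (h.fun_beta (h.var _) h.fun_zero) (h.fun_unpair_fst (h.var _))
  · exact h.fun_lt (h.var _) (h.fun_unpair_snd (h.var _))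
  · exact h.fun_mem hq (h.fun_beta (h.var _) (h.fun_add (h.var _) h.fun_one))
      (h.fun_pair (h.fun_unpair_fst (h.var _))
        (h.fun_pair (h.var _) (h.fun_beta (h.var _) (h.var _))))
  · exact h.fun_eq (h.var _) (h.fun_beta (h.var _) (h.fun_unpair_snd (h.var _)))

theorem mem_rfind {D : RelFamily ℕ} (h : SemiringClosed D) {p : ℕ →. ℕ}
    (hp : D 2 fun x => x 0 ∈ p (x 1)) :
    D 2 fun x => x 0 ∈ Nat.rfind fun n => (fun m => m = 0) <$> p (Nat.pair (x 1) n) := by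
  refine RelFamily.congr (h.and
    (h.fun_mem hp h.fun_zero (h.fun_pair (h.var 1) (h.var 0)))
    (h.all (R := fun x m => m < x 0 → ∃ w, w ∈ p (Nat.pair (x 1) m) ∧ w ≠ 0)
      (h.imp (h.fun_lt (h.var _) (h.var _)) (h.ex
        (h.and (h.fun_mem hp (h.var _) (h.fun_pair (h.var _) (h.var _)))
          (h.not (h.fun_eq (h.var _) h.fun_zero))))))) fun x => ?_
  refine Iff.trans ?_ Nat.mem_rfind.symm
  simp [and_comm]

theorem partrec {D : RelFamily ℕ} (h : SemiringClosed D) {p : ℕ →. ℕ} (hp : Nat.Partrec p) :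
    D 2 fun x => x 0 ∈ p (x 1) := by
  induction hp with
  | zero =>
    exact RelFamily.congr (h.fun_eq (h.var 0) h.fun_zero) fun x => by simp [pure, PFun.pure]
  | succ =>
    exact RelFamily.congr (h.fun_eq (h.var 0) (h.fun_add (h.var 1) h.fun_one)) fun x => by simp
  | left =>
    exact RelFamily.congr (h.fun_eq (h.var 0) (h.fun_unpair_fst (h.var 1))) fun x => by simp
  | right =>
    exact RelFamily.congr (h.fun_eq (h.var 0) (h.fun_unpair_snd (h.var 1))) fun x => by simp
  | @pair f g _ _ hf hg =>
    refine RelFamily.congr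
      (h.ex (R := fun x a => a ∈ f (x 1) ∧ ∃ b, b ∈ g (x 1) ∧ x 0 = Nat.pair a b)
        (h.and (h.fun_mem hf (h.var _) (h.var _)) (h.ex (h.and
          (h.fun_mem hg (h.var _) (h.var _))
          (h.fun_eq (h.var _) (h.fun_pair (h.var _) (h.var _))))))) fun x => ?_
    simp [Seq.seq, eq_comm]
  | @comp f g _ _ hf hg =>
    exact RelFamily.congr (h.ex (R := fun x a => a ∈ g (x 1) ∧ x 0 ∈ f a)
      (h.and (h.fun_mem hg (h.var _) (h.var _)) (h.fun_mem hf (h.var _) (h.var _))))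
      fun x => Part.mem_bind_iff.symm
  | prec _ _ hf hg => exact h.mem_prec hf hg
  | rfind _ hf => exact h.mem_rfind hf

/-- Robinson: `n ^ 2 + n` is the least common multiple of `n` and `n + 1`, and squaring yields
multiplication by polarization. -/
theorem of_dvd {D : RelFamily ℕ} (h : FirstOrderClosed D) (hadd : D 3 fun x => x 0 = x 1 + x 2)
    (hdvd : D 2 fun x => x 0 ∣ x 1) : SemiringClosed D := by
  have fun_add {n : ℕ} {f g : (Fin n → ℕ) → ℕ} (hf : DefinableFun D f) (hg : DefinableFun D g) :
      DefinableFun D fun x => f x + g x := h.fun_comp₂ hadd hf hg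
  have fun_dvd {n : ℕ} {f g : (Fin n → ℕ) → ℕ} (hf : DefinableFun D f) (hg : DefinableFun D g) :
      D n fun x => f x ∣ g x := h.comp₂ hdvd hf hg
  have one_def : D 1 fun x => x 0 = 1 :=
    RelFamily.congr (h.all (R := fun x a => x 0 ∣ a) (fun_dvd (h.var _) (h.var _))) fun _ =>
      ⟨fun hx => Nat.dvd_one.1 (hx 1), fun hx a => by rw [hx]; exact one_dvd a⟩
  have lcm_def : D 3 fun x => x 0 = Nat.lcm (x 1) (x 2) := by
    refine RelFamily.congr (h.all (R := fun x m => x 0 ∣ m ↔ x 1 ∣ m ∧ x 2 ∣ m)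
      (h.iff (fun_dvd (h.var _) (h.var _))
        (h.and (fun_dvd (h.var _) (h.var _)) (fun_dvd (h.var _) (h.var _))))) fun x => ?_
    simp only [← Nat.lcm_dvd_iff]
    exact Nat.dvd_right_iff_eq
  have sq_def : D 2 fun x => x 0 = x 1 * x 1 := by
    refine RelFamily.congr (h.fun_eq (fun_add (h.var 0) (h.var 1)) (h.fun_comp₂ lcm_def (h.var 1)
      (fun_add (h.var 1) (h.const one_def)))) fun x => ?_
    rw [Nat.Coprime.lcm_eq_mul (by simp), mul_add, mul_one, add_left_inj]
  have fun_sq {n : ℕ} {f : (Fin n → ℕ) → ℕ} (hf : DefinableFun D f) :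
      DefinableFun D fun x => f x * f x := h.fun_comp₁ (F := fun a => a * a) sq_def hf
  refine { h with add := hadd, mul := RelFamily.congr (h.fun_eq
    (fun_sq (fun_add (h.var 1) (h.var 2))) (fun_add (fun_add (fun_sq (h.var 1))
      (fun_add (h.var 0) (h.var 0))) (fun_sq (h.var 2)))) fun x => ?_ }
  constructor <;> intro hx <;> linarith

end SemiringClosed

theorem exists_arithmetical_not_computablePred : ∃ H : ℕ → Prop, ¬ ComputablePred H ∧
    ∀ D : RelFamily ℕ, SemiringClosed D → D 1 fun x => H (x 0) := by
  let p : ℕ →. ℕ := fun n => (Denumerable.ofNat Nat.Partrec.Code n).eval 0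
  have hp : Nat.Partrec p := Partrec.nat_iff.1
    (Nat.Partrec.Code.eval_part.comp (Computable.ofNat _) (Computable.const 0))
  refine ⟨fun n => (p n).Dom, fun hc => ComputablePred.halting_problem 0 ?_, fun D h => ?_⟩
  · refine (ComputablePred.computable_of_manyOneReducible
      (ManyOneReducible.mk _ Computable.encode) hc).of_eq fun c => ?_
    simp [p]
  · exact RelFamily.congr (h.ex (R := fun x a => a ∈ p (x 0)) (h.partrec hp)) fun _ =>
      Part.dom_iff_mem.symm

/-! ### Natural numbers as powers of `X` -/

section Polynomial

open Polynomial

theorem natDegree_X_pow_sub_one {R : Type*} [Ring R] [Nontrivial R] (n : ℕ) :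
    (X ^ n - 1 : R[X]).natDegree = n :=
  natDegree_X_pow_sub_C (r := (1 : R))

theorem X_pow_sub_one_eq_zero_iff {R : Type*} [Ring R] [Nontrivial R] {n : ℕ} :
    (X ^ n - 1 : R[X]) = 0 ↔ n = 0 :=
  ⟨fun h => by simpa only [natDegree_X_pow_sub_one, natDegree_zero] using congrArg natDegree h,
    fun h => by rw [h, pow_zero, sub_self]⟩

theorem X_pow_sub_one_dvd_iff {R : Type*} [CommRing R] [Nontrivial R] {n m : ℕ} :
    (X ^ n - 1 : R[X]) ∣ X ^ m - 1 ↔ n ∣ m := by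
  refine ⟨fun h => ?_, fun ⟨l, hl⟩ => hl ▸ pow_one_sub_dvd_pow_mul_sub_one X n l⟩
  obtain rfl | hn := eq_or_ne n 0
  · rwa [pow_zero, sub_self, zero_dvd_iff, X_pow_sub_one_eq_zero_iff, ← zero_dvd_iff] at h
  have hdiv : (X ^ m - 1 : R[X]) =
      X ^ (m % n) * (X ^ (n * (m / n)) - 1) + (X ^ (m % n) - 1) := by
    rw [mul_sub, ← pow_add, Nat.mod_add_div]
    ring
  rw [hdiv, dvd_add_right ((pow_one_sub_dvd_pow_mul_sub_one _ _ _).mul_left _)] at h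
  by_contra hnm
  refine (monic_X_pow_sub_C (1 : R) hn).not_dvd_of_natDegree_lt ?_ ?_ h
  · rwa [Ne, X_pow_sub_one_eq_zero_iff, ← Nat.dvd_iff_mod_eq_zero]
  · rw [natDegree_X_pow_sub_one, natDegree_X_pow_sub_C]
    exact Nat.mod_lt m (Nat.pos_of_ne_zero hn)

theorem exists_eq_X_pow_iff {R : Type*} [CommRing R] [IsDomain R] (P : R[X]) :
    (∃ n : ℕ, P = X ^ n) ↔ X - 1 ∣ P - 1 ∧ ∀ Q, Q ∣ P → Q ∣ 1 ∨ X ∣ Q := by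
  constructor
  · rintro ⟨n, rfl⟩
    refine ⟨sub_one_dvd_pow_sub_one X n, fun Q hQ => ?_⟩
    obtain ⟨i, -, hi⟩ := (dvd_prime_pow prime_X n).1 hQ
    obtain rfl | hi0 := eq_or_ne i 0
    · exact Or.inl (hi.dvd.trans (pow_zero X).dvd)
    · exact Or.inr ((dvd_pow_self X hi0).trans hi.symm.dvd)
  · rintro ⟨h1, hX⟩
    have heval : P.eval 1 = 1 := by
      rw [← C_1, dvd_iff_isRoot] at h1
      simpa [sub_eq_zero] using h1
    have hP : P ≠ 0 := by
      rintro rfl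
      simp at heval
    obtain ⟨Q, hPQ, hQ⟩ := exists_eq_pow_rootMultiplicity_mul_and_not_dvd P hP 0
    rw [C_0, sub_zero] at hPQ hQ
    have hunit := (hX Q ⟨_, hPQ.trans (mul_comm _ _)⟩).resolve_right hQ
    obtain ⟨c, -, rfl⟩ := Polynomial.isUnit_iff.1 (isUnit_of_dvd_one hunit)
    refine ⟨rootMultiplicity 0 P, ?_⟩
    have hc : c = 1 := by rwa [hPQ, eval_mul, eval_pow, eval_X, one_pow, one_mul, eval_C] at heval
    rwa [hc, C_1, mul_one] at hPQ

/-- The coding of a natural number `n` by the polynomial `X ^ n`. -/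
def PowCode {R : Type*} [Semiring R] (P : R[X]) (n : ℕ) : Prop := P = X ^ n

theorem X_pow_inj {R : Type*} [Semiring R] [Nontrivial R] {n m : ℕ} :
    (X ^ n : R[X]) = X ^ m ↔ n = m :=
  ⟨fun h => by simpa only [natDegree_X_pow] using congrArg natDegree h, congrArg _⟩

namespace SemiringClosed

variable {R : Type*} [CommRing R] [IsDomain R] {D : RelFamily R[X]} (h : SemiringClosed D)
  (hX : D 1 fun P => P 0 = X)

include h hX

theorem isCoding_powCode : IsCoding D (PowCode (R := R)) where
  rightUnique _ _ _ hn hm := X_pow_inj.1 (hn.symm.trans hm)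
  rightTotal n := ⟨X ^ n, rfl⟩
  dom := RelFamily.congr
    (h.and
      (h.fun_dvd (h.fun_sub (h.const hX) h.fun_one) (h.fun_sub (h.var 0) h.fun_one))
      (h.all (R := fun P Q => Q ∣ P 0 → Q ∣ 1 ∨ X ∣ Q)
        (h.imp (h.fun_dvd (h.var _) (h.var _))
          (h.or (h.fun_dvd (h.var _) h.fun_one) (h.fun_dvd (h.const hX) (h.var _))))))
    fun P => (exists_eq_X_pow_iff (P 0)).symm

theorem coded_powCode : SemiringClosed (D.coded PowCode) := by
  have hC := h.isCoding_powCode hX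
  refine of_dvd (h.coded hC ?_) ?_ ?_
  · exact h.coded_of hC (h.eq 0 1) fun P n hP => by rw [hP 0, hP 1, X_pow_inj]
  · exact h.coded_of hC h.mul fun P n hP => by rw [hP 0, hP 1, hP 2, ← pow_add, X_pow_inj]
  · refine h.coded_of hC (h.fun_dvd (h.fun_sub (h.var 0) h.fun_one)
      (h.fun_sub (h.var 1) h.fun_one)) fun P n hP => ?_
    rw [hP 0, hP 1, X_pow_sub_one_dvd_iff]

end SemiringClosed

end Polynomial

/-! ### Total residue maps -/

namespace LResStructure

open LRes Polynomial

section TotalResidue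

variable {K V k : Type*} [Ring K] [Zero V] [Top V] [Add V] [LT V] [Ring k]
  {M : LResStructure K V k}

/-- `a` is a constant of `K` as far as the residue map can see: `res` is `a`-linear. -/
def IsConst (M : LResStructure K V k) (a : K) : Prop :=
  ∀ x, M.res (a * x) = M.res a * M.res x

/-- The pair `(t, y)`, with `t` of positive valuation, codes the polynomial
`∑ res (y * t ^ n) * X ^ n`. -/
def PolyCode (M : LResStructure K V k) (p : K × K) (P : k[X]) : Prop :=
  0 < M.val p.1 ∧ ∀ n, P.coeff n = M.res (p.2 * p.1 ^ n)

/-- The coding of a natural number `n` by a code `(t, y)` of the polynomial `X ^ n`. -/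
def NatCode (M : LResStructure K V k) : K × K → ℕ → Prop := Relation.Comp M.PolyCode PowCode

theorem NatCode.res_mul_pow_eq_one_iff [Nontrivial k] {t y : K} {m : ℕ}
    (hm : M.NatCode (t, y) m) (n : ℕ) : M.res (y * t ^ n) = 1 ↔ n = m := by
  obtain ⟨_, hP, rfl⟩ := hm
  rw [← hP.2, coeff_X_pow]
  simp

/-- The properties of the total residue maps of rank one that matter here: `res` is additive and
linear over a set of constants that maps onto `k`, and it vanishes far out on the powers of any
element of positive valuation. -/
structure IsTotalResidue (M : LResStructure K V k) : Prop where
  res_add : ∀ x y, M.res (x + y) = M.res x + M.res y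
  res_one : M.res 1 = 1
  exists_isConst : ∀ c, ∃ a, M.IsConst a ∧ M.res a = c
  exists_res_mul_pow_eq_zero : ∀ {t}, 0 < M.val t → ∀ y, ∃ N, ∀ n ≥ N, M.res (y * t ^ n) = 0
  res_pow_eq_zero : ∀ {t}, 0 < M.val t → ∀ {n}, n ≠ 0 → M.res (t ^ n) = 0
  exists_val_pos : ∃ t ≠ 0, 0 < M.val t

theorem PolyCode.add (h : M.IsTotalResidue) {t y z : K} {P Q : k[X]} (hP : M.PolyCode (t, y) P)
    (hQ : M.PolyCode (t, z) Q) : M.PolyCode (t, y + z) (P + Q) :=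
  ⟨hP.1, fun n => by rw [coeff_add, hP.2, hQ.2, add_mul, h.res_add]⟩

namespace IsTotalResidue

variable (h : M.IsTotalResidue)

include h

theorem res_zero : M.res 0 = 0 := by
  simpa using h.res_add 0 0

theorem exists_polyCode {t : K} (ht : 0 < M.val t) (y : K) : ∃ P, M.PolyCode (t, y) P := by
  obtain ⟨N, hN⟩ := h.exists_res_mul_pow_eq_zero ht y
  refine ⟨∑ n ∈ Finset.range N, monomial n (M.res (y * t ^ n)), ht, fun n => ?_⟩
  simp only [finsetSum_coeff, coeff_monomial, Finset.sum_ite_eq', Finset.mem_range]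
  split_ifs with hn
  · rfl
  · exact (hN n (not_lt.1 hn)).symm

end IsTotalResidue

end TotalResidue

section GeometricSeries

variable {K V k : Type*} [Field K] [Zero V] [Top V] [Add V] [LT V] [Field k]
  {M : LResStructure K V k}

namespace IsTotalResidue

variable (h : M.IsTotalResidue)

include h

theorem one_sub_mul_ne_zero {a t : K} (ha : M.IsConst a) (ht : 0 < M.val t) : 1 - a * t ≠ 0 := by
  intro h0
  refine one_ne_zero (α := k) ?_
  rw [← h.res_one, sub_eq_zero.1 h0, ha, ← pow_one t, h.res_pow_eq_zero ht one_ne_zero, mul_zero]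

theorem res_mul_inv_one_sub {a t : K} (ha : M.IsConst a) (ht : 0 < M.val t) (y : K) (N : ℕ) :
    M.res (y * (1 - a * t)⁻¹) = ∑ n ∈ Finset.range N, M.res (y * t ^ n) * M.res a ^ n +
      M.res a ^ N * M.res (y * (1 - a * t)⁻¹ * t ^ N) := by
  have hne := h.one_sub_mul_ne_zero ha ht
  induction N with
  | zero => simp
  | succ N ih =>
    have hgeom : y * (1 - a * t)⁻¹ * t ^ N =
        y * t ^ N + a * (y * (1 - a * t)⁻¹ * t ^ (N + 1)) := by
      field_simp
      ring
    rw [ih, hgeom, h.res_add, ha, Finset.sum_range_succ]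
    ring

theorem eval_res {p : K × K} {P : k[X]} (hP : M.PolyCode p P) {a : K} (ha : M.IsConst a) :
    P.eval (M.res a) = M.res (p.2 * (1 - a * p.1)⁻¹) := by
  obtain ⟨N, hN⟩ := h.exists_res_mul_pow_eq_zero hP.1 (p.2 * (1 - a * p.1)⁻¹)
  have hdeg : P.natDegree < max N (P.natDegree + 1) := by lia
  rw [h.res_mul_inv_one_sub ha hP.1 p.2 (max N (P.natDegree + 1)), hN _ (le_max_left _ _),
    mul_zero, add_zero, eval_eq_sum_range' hdeg]
  exact Finset.sum_congr rfl fun n _ => by rw [hP.2]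

theorem exists_polyCode_coeff_eq {t : K} (ht0 : t ≠ 0) (ht : 0 < M.val t) (d : ℕ) (c : k) :
    ∃ y Q, M.PolyCode (t, y) Q ∧ Q.coeff d = c ∧ ∀ n > d, Q.coeff n = 0 := by
  obtain ⟨a, ha, rfl⟩ := h.exists_isConst c
  obtain ⟨Q, hQ⟩ := h.exists_polyCode ht (a * (t ^ d)⁻¹)
  have hcoeff (i : ℕ) : Q.coeff (d + i) = M.res a * M.res (t ^ i) := by
    rw [hQ.2, ← ha, pow_add, mul_assoc, inv_mul_cancel_left₀ (pow_ne_zero d ht0)]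
  refine ⟨_, Q, hQ, by simpa [h.res_one] using hcoeff 0, fun n hn => ?_⟩
  obtain ⟨i, rfl⟩ := Nat.exists_eq_add_of_lt hn
  rw [add_assoc, hcoeff, h.res_pow_eq_zero ht i.succ_ne_zero, mul_zero]

theorem exists_polyCode_of_degree_lt {t : K} (ht0 : t ≠ 0) (ht : 0 < M.val t) {d : ℕ} {P : k[X]}
    (hP : P.degree < d) : ∃ y, M.PolyCode (t, y) P := by
  induction d generalizing P with
  | zero =>
    obtain rfl : P = 0 := by simpa using hP
    exact ⟨0, ht, fun n => by rw [coeff_zero, zero_mul, h.res_zero]⟩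
  | succ d ih =>
    obtain ⟨z, Q, hQ, hQd, hQn⟩ := h.exists_polyCode_coeff_eq ht0 ht d (P.coeff d)
    have hPQ : (P - Q).degree < d := by
      rw [degree_lt_iff_coeff_zero] at hP ⊢
      intro n hn
      obtain rfl | hn := hn.eq_or_lt
      · rw [coeff_sub, hQd, sub_self]
      · rw [coeff_sub, hP n hn, hQn n hn, sub_self]
    obtain ⟨y, hy⟩ := ih hPQ
    exact ⟨y + z, sub_add_cancel P Q ▸ hy.add h hQ⟩

end IsTotalResidue

end GeometricSeries

/-! ### Definability in the field sort -/

section FieldDefinable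

variable {K V k : Type*} [Ring K] [Zero V] [Top V] [Add V] [LT V] [Ring k]
  (M : LResStructure K V k)

/-- The relations on the field sort that are definable without parameters; `σ` lists the names of
the variables. -/
def fieldDefinable : RelFamily K := fun n R => ∀ σ : Fin n → ℕ, ∃ φ : Formula,
  φ.freeVars ⊆ Prod.mk .K '' Set.range σ ∧ ∀ e : Assignment K V k,
    M.Satisfies e φ ↔ R fun i => e.toK (σ i)

theorem fieldDefinable_ex {n : ℕ} {R : (Fin n → K) → K → Prop}
    (hR : M.fieldDefinable (n + 1) fun y => R (fun i => y i.succ) (y 0)) :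
    M.fieldDefinable n fun x => ∃ a, R x a := by
  intro σ
  obtain ⟨N, hN⟩ := (Set.finite_range σ).exists_notMem
  obtain ⟨φ, hfree, hφ⟩ := hR (Fin.cons N σ)
  refine ⟨.exK N φ, ?_, fun e => exists_congr fun a => (hφ _).trans ?_⟩
  · rwa [Fin.range_cons, Set.image_insert_eq, ← Set.sdiff_singleton_subset_iff] at hfree
  · have hne (i : Fin n) : σ i ≠ N := fun h => hN ⟨i, h⟩
    simp only [Fin.cons_zero, Fin.cons_succ, Function.update_self, Function.update_of_ne (hne _)]

theorem firstOrderClosed_fieldDefinable : FirstOrderClosed M.fieldDefinable where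
  eq i j σ := ⟨.eqK (.var (σ i)) (.var (σ j)),
    by simp [Formula.freeVars, TermK.vars, Set.insert_subset_iff], fun _ => Iff.rfl⟩
  not hR σ :=
    have ⟨φ, hfree, hφ⟩ := hR σ
    ⟨.not φ, hfree, fun e => not_congr (hφ e)⟩
  and hR hS σ :=
    have ⟨φ, hfreeφ, hφ⟩ := hR σ
    have ⟨ψ, hfreeψ, hψ⟩ := hS σ
    ⟨.and φ ψ, Set.union_subset hfreeφ hfreeψ, fun e => and_congr (hφ e) (hψ e)⟩
  ex := M.fieldDefinable_ex
  reindex ρ hR σ :=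
    have ⟨φ, hfree, hφ⟩ := hR fun i => σ (ρ i)
    ⟨φ, hfree.trans (Set.image_mono (Set.range_comp_subset_range ρ σ)), hφ⟩

theorem semiringClosed_fieldDefinable : SemiringClosed M.fieldDefinable where
  toFirstOrderClosed := M.firstOrderClosed_fieldDefinable
  add σ := ⟨.eqK (.var (σ 0)) (.add (.var (σ 1)) (.var (σ 2))),
    by simp [Formula.freeVars, TermK.vars, Set.insert_subset_iff], fun _ => Iff.rfl⟩
  mul σ := ⟨.eqK (.var (σ 0)) (.mul (.var (σ 1)) (.var (σ 2))),
    by simp [Formula.freeVars, TermK.vars, Set.insert_subset_iff], fun _ => Iff.rfl⟩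

theorem fieldDefinable_val_pos : M.fieldDefinable 1 fun x => 0 < M.val (x 0) := fun σ =>
  ⟨.ltV .zero (.val (.var (σ 0))), by simp [Formula.freeVars, TermK.vars, TermV.vars],
    fun _ => Iff.rfl⟩

theorem fieldDefinable_res_eq : M.fieldDefinable 2 fun x => M.res (x 0) = M.res (x 1) := fun σ =>
  ⟨.eqR (.res (.var (σ 0))) (.res (.var (σ 1))),
    by simp [Formula.freeVars, TermK.vars, TermR.vars, Set.insert_subset_iff], fun _ => Iff.rfl⟩

theorem fieldDefinable_res_add :
    M.fieldDefinable 3 fun x => M.res (x 0) = M.res (x 1) + M.res (x 2) := fun σ =>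
  ⟨.eqR (.res (.var (σ 0))) (.add (.res (.var (σ 1))) (.res (.var (σ 2)))),
    by simp [Formula.freeVars, TermK.vars, TermR.vars, Set.insert_subset_iff], fun _ => Iff.rfl⟩

theorem fieldDefinable_res_mul :
    M.fieldDefinable 3 fun x => M.res (x 0) = M.res (x 1) * M.res (x 2) := fun σ =>
  ⟨.eqR (.res (.var (σ 0))) (.mul (.res (.var (σ 1))) (.res (.var (σ 2)))),
    by simp [Formula.freeVars, TermK.vars, TermR.vars, Set.insert_subset_iff], fun _ => Iff.rfl⟩

theorem fieldDefinable_isConst : M.fieldDefinable 1 fun x => M.IsConst (x 0) :=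
  have hK := M.semiringClosed_fieldDefinable
  hK.all (R := fun x b => M.res (x 0 * b) = M.res (x 0) * M.res b)
    (hK.comp₃ (Q := fun a b c => M.res a = M.res b * M.res c) M.fieldDefinable_res_mul
      (hK.fun_mul (hK.var _) (hK.var _)) (hK.var _) (hK.var _))

end FieldDefinable

section PolyDefinable

variable {K V k : Type*} [Field K] [Zero V] [Top V] [Add V] [LT V] [Field k]
  {M : LResStructure K V k}

namespace IsTotalResidue

variable (h : M.IsTotalResidue)

include h

theorem isCoding_polyCode : IsCoding M.fieldDefinable.pairs M.PolyCode where
  rightUnique p P Q hP hQ := by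
    ext n
    rw [hP.2, hQ.2]
  rightTotal P := by
    obtain ⟨t, ht0, ht⟩ := h.exists_val_pos
    obtain ⟨y, hy⟩ := h.exists_polyCode_of_degree_lt ht0 ht
      (degree_le_natDegree.trans_lt (Nat.cast_lt.2 P.natDegree.lt_succ_self))
    exact ⟨(t, y), hy⟩
  dom m σ _ :=
    have hK := M.firstOrderClosed_fieldDefinable
    RelFamily.congr (hK.reindex (fun _ => σ 0) M.fieldDefinable_val_pos) fun _ =>
      ⟨fun ht => h.exists_polyCode ht _, fun ⟨_, hP⟩ => hP.1⟩

theorem coded_polyCode_forall_eval {n : ℕ} {Q : k → (Fin n → k) → Prop}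
    (hQ : M.fieldDefinable (n + 1) fun x => Q (M.res (x 0)) fun i => M.res (x i.succ)) :
    M.fieldDefinable.pairs.coded M.PolyCode n fun P => ∀ c, Q c fun i => (P i).eval c := by
  have hK := M.semiringClosed_fieldDefinable
  refine hK.pairs.coded_of h.isCoding_polyCode (S := fun u => ∀ a, M.IsConst a →
    Q (M.res a) fun i => M.res ((u i).2 * (1 - a * (u i).1)⁻¹)) (fun m σ τ => ?_)
    fun u P hP => ?_
  · exact hK.all (hK.imp (hK.reindex (fun _ => 0) M.fieldDefinable_isConst)
      (hK.comp (f := Fin.cons (fun y => y 0) fun i y =>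
          y (τ i).succ * (1 - y 0 * y (σ i).succ)⁻¹) hQ
        (Fin.forall_fin_succ.2 ⟨hK.var 0, fun i => hK.fun_mul (hK.var _)
          (hK.fun_inv (hK.fun_sub hK.fun_one (hK.fun_mul (hK.var _) (hK.var _))))⟩)))
  · have heval {a : K} (ha : M.IsConst a) : (fun i => (P i).eval (M.res a)) =
        fun i => M.res ((u i).2 * (1 - a * (u i).1)⁻¹) := funext fun i => h.eval_res (hP i) ha
    constructor
    · intro hx a ha
      rw [← heval ha]
      exact hx _
    · intro hx c
      obtain ⟨a, ha, rfl⟩ := h.exists_isConst c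
      rw [heval ha]
      exact hx a ha

variable [Infinite k]

theorem coded_polyCode_eq : M.fieldDefinable.pairs.coded M.PolyCode 2 fun P => P 0 = P 1 :=
  RelFamily.congr (h.coded_polyCode_forall_eval (Q := fun _ v => v 0 = v 1)
    (M.firstOrderClosed_fieldDefinable.reindex Fin.succ M.fieldDefinable_res_eq))
    fun _ => ⟨Polynomial.funext, fun hP c => congrArg (eval c) hP⟩

theorem coded_polyCode_eq_X : M.fieldDefinable.pairs.coded M.PolyCode 1 fun P => P 0 = X :=
  RelFamily.congr (h.coded_polyCode_forall_eval (Q := fun c v => v 0 = c)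
    (M.firstOrderClosed_fieldDefinable.reindex ![1, 0] M.fieldDefinable_res_eq))
    fun _ => ⟨fun hP => Polynomial.funext fun c => (hP c).trans eval_X.symm,
      fun hP c => (congrArg (eval c) hP).trans eval_X⟩

theorem semiringClosed_coded_polyCode :
    SemiringClosed (M.fieldDefinable.pairs.coded M.PolyCode) where
  toFirstOrderClosed := M.firstOrderClosed_fieldDefinable.pairs.coded h.isCoding_polyCode
    h.coded_polyCode_eq
  add := RelFamily.congr (h.coded_polyCode_forall_eval (Q := fun _ v => v 0 = v 1 + v 2)
    (M.firstOrderClosed_fieldDefinable.reindex Fin.succ M.fieldDefinable_res_add))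
    fun _ => ⟨fun hP => Polynomial.funext fun c => (hP c).trans eval_add.symm,
      fun hP c => (congrArg (eval c) hP).trans eval_add⟩
  mul := RelFamily.congr (h.coded_polyCode_forall_eval (Q := fun _ v => v 0 = v 1 * v 2)
    (M.firstOrderClosed_fieldDefinable.reindex Fin.succ M.fieldDefinable_res_mul))
    fun _ => ⟨fun hP => Polynomial.funext fun c => (hP c).trans eval_mul.symm,
      fun hP c => (congrArg (eval c) hP).trans eval_mul⟩

theorem isCoding_natCode : IsCoding M.fieldDefinable.pairs M.NatCode :=
  h.isCoding_polyCode.comp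
    (h.semiringClosed_coded_polyCode.isCoding_powCode h.coded_polyCode_eq_X)

theorem semiringClosed_coded_natCode : SemiringClosed (M.fieldDefinable.pairs.coded M.NatCode) :=
  RelFamily.coded_coded M.fieldDefinable.pairs M.PolyCode PowCode ▸
    h.semiringClosed_coded_polyCode.coded_powCode h.coded_polyCode_eq_X

end IsTotalResidue

end PolyDefinable

/-! ### Interpretation of arithmetic -/

section Interprets

variable {K V k : Type*} [Ring K] [Zero V] [Top V] [Add V] [LT V] [Ring k]
  {M : LResStructure K V k}

theorem exists_formula_of_pairs {n : ℕ} {S : (Fin n → K × K) → Prop}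
    (hS : M.fieldDefinable.pairs n S) (σ τ : Fin n → ℕ) : ∃ φ : Formula,
      φ.freeVars ⊆ Prod.mk .K '' (Set.range σ ∪ Set.range τ) ∧ ∀ e : Assignment K V k,
        M.Satisfies e φ ↔ S fun i => (e.toK (σ i), e.toK (τ i)) := by
  obtain ⟨φ, hfree, hφ⟩ := hS (n + n) (Fin.castAdd n) (Fin.natAdd n) (Fin.append σ τ)
  refine ⟨φ, hfree.trans (Set.image_mono (Set.range_subset_iff.2 fun i => ?_)), fun e => ?_⟩
  · cases i using Fin.addCases with
    | left i => exact Or.inl ⟨i, (Fin.append_left σ τ i).symm⟩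
    | right i => exact Or.inr ⟨i, (Fin.append_right σ τ i).symm⟩
  · simpa only [Fin.append_left, Fin.append_right] using hφ e

theorem definable_of_pairs {n : ℕ} {S : (Fin n → K × K) → Prop}
    (hS : M.fieldDefinable.pairs n S) :
    M.Definable {x : Fin n → Tuple K V k 2 0 0 | S fun j => ((x j).1 0, (x j).1 1)} :=
  have ⟨φ, _, hφ⟩ := exists_formula_of_pairs hS (fun j => Nat.pair j 0) fun j => Nat.pair j 1
  ⟨φ, hφ⟩

theorem interprets_of_isCoding {L : FirstOrder.Language} {N : Type*} [L.Structure N]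
    {C : K × K → N → Prop} (hC : IsCoding M.fieldDefinable.pairs C)
    (heq : M.fieldDefinable.pairs.coded C 2 fun b => b 0 = b 1)
    (hfun : ∀ n (F : L.Functions n), M.fieldDefinable.pairs.coded C (n + 1) fun b =>
      FirstOrder.Language.Structure.funMap F (fun j => b j.castSucc) = b (Fin.last n))
    (hrel : ∀ n (R : L.Relations n), M.fieldDefinable.pairs.coded C n fun b =>
      FirstOrder.Language.Structure.RelMap R b) : M.Interprets L N := by
  let X : Set (Tuple K V k 2 0 0) := {u | ∃ n, C (u.1 0, u.1 1) n}
  let f : X → N := fun u => u.2.choose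
  have hf (u : X) : C (u.1.1 0, u.1.1 1) (f u) := u.2.choose_spec
  have definable {n : ℕ} {R : (Fin n → N) → Prop} (hR : M.fieldDefinable.pairs.coded C n R) :
      M.Definable {x : Fin n → Tuple K V k 2 0 0 |
        ∃ h : ∀ j, x j ∈ X, R fun j => f ⟨x j, h j⟩} := by
    obtain ⟨φ, hφ⟩ := definable_of_pairs hR
    refine ⟨φ, fun e => (hφ e).trans ⟨?_, fun ⟨hx, hR⟩ => ⟨_, fun j => hf ⟨_, hx j⟩, hR⟩⟩⟩
    rintro ⟨b, hb, hR⟩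
    refine ⟨fun j => ⟨b j, hb j⟩, ?_⟩
    rwa [show (fun j => f _) = b from funext fun j => hC.rightUnique (hf _) (hb j)]
  refine ⟨2, 0, 0, X, f, fun n => ?_, definable_of_pairs hC.dom, definable heq,
    fun n F => definable (hfun n F), fun n R => definable (hrel n R)⟩
  obtain ⟨⟨t, y⟩, hn⟩ := hC.rightTotal n
  exact ⟨⟨(![t, y], ![], ![]), n, hn⟩, hC.rightUnique (hf _) hn⟩

theorem interprets_arith {C : K × K → ℕ → Prop} (hC : IsCoding M.fieldDefinable.pairs C)
    (h : SemiringClosed (M.fieldDefinable.pairs.coded C)) : M.Interprets arithLanguage ℕ := by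
  refine interprets_of_isCoding hC (h.eq 0 1) (fun n F => ?_) fun n R => nomatch R
  cases F with
  | add => exact h.fun_eq (h.fun_add (h.var 0) (h.var 1)) (h.var 2)
  | mul => exact h.fun_eq (h.fun_mul (h.var 0) (h.var 1)) (h.var 2)

end Interprets

/-! ### Undecidability -/

section Undecidable

/-- The `n`-th power of the term `s`. -/
def powTerm (s : TermK) : ℕ → TermK
  | 0 => .one
  | n + 1 => .mul (powTerm s n) s

theorem vars_powTerm_subset (s : TermK) (n : ℕ) : (powTerm s n).vars ⊆ s.vars := by
  induction n with
  | zero => exact Set.empty_subset _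
  | succ n ih => exact Set.union_subset ih subset_rfl

theorem evalK_powTerm {K V k : Type*} [Ring K] (e : Assignment K V k) (s : TermK) (n : ℕ) :
    evalK e (powTerm s n) = evalK e s ^ n := by
  induction n with
  | zero => exact (pow_zero _).symm
  | succ n ih => rw [pow_succ, ← ih]; rfl

theorem primrec_code_powTerm (s : TermK) : Primrec fun n => (powTerm s n).code := by
  refine (Primrec.nat_rec₁ TermK.one.code (f := fun _ m => Nat.pair 5 (Nat.pair m s.code))
    (Primrec₂.natPair.comp (.const 5)
      (Primrec₂.natPair.comp .snd (.const s.code))).to₂).of_eq fun n => ?_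
  induction n with
  | zero => rfl
  | succ n ih => exact congrArg (fun m => Nat.pair 5 (Nat.pair m s.code)) ih

/-- The formula `∃ t y, φ ∧ res (y * t ^ n) = 1`, where `t` and `y` are the variables `0`
and `1`. -/
def exCoeffEqOne (φ : Formula) (n : ℕ) : Formula :=
  .exK 0 (.exK 1 (.and φ (.eqR (.res (.mul (.var 1) (powTerm (.var 0) n))) .one)))

theorem isSentence_exCoeffEqOne {φ : Formula} (hφ : φ.freeVars ⊆ {(.K, 0), (.K, 1)}) (n : ℕ) :
    (exCoeffEqOne φ n).IsSentence := by
  have hpow : (powTerm (.var 0) n).vars ⊆ {(.K, 1), (.K, 0)} :=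
    (vars_powTerm_subset _ n).trans (by simp [TermK.vars])
  rw [Set.pair_comm] at hφ
  rw [Formula.IsSentence, ← Set.subset_empty_iff]
  simp only [exCoeffEqOne, Formula.freeVars, TermR.vars, TermK.vars,
    Set.sdiff_singleton_subset_iff, insert_empty_eq, Set.union_subset_iff]
  simp [hφ, hpow]

theorem satisfies_exCoeffEqOne_iff {K V k : Type*} [Ring K] [Zero V] [Top V] [Add V] [LT V] [Ring k]
    {M : LResStructure K V k} {φ : Formula} {S : K → K → Prop}
    (hφ : ∀ e : Assignment K V k, M.Satisfies e φ ↔ S (e.toK 0) (e.toK 1)) (n : ℕ)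
    (e : Assignment K V k) :
    M.Satisfies e (exCoeffEqOne φ n) ↔ ∃ t y, S t y ∧ M.res (y * t ^ n) = 1 := by
  refine exists_congr fun t => exists_congr fun y => and_congr ((hφ _).trans ?_) ?_
  · simp
  · simp [Satisfies, evalR, evalK, evalK_powTerm]

theorem primrec_code_exCoeffEqOne (φ : Formula) : Primrec fun n => (exCoeffEqOne φ n).code := by
  have pair (c : ℕ) {u : ℕ → ℕ} (hu : Primrec u) : Primrec fun n => Nat.pair c (u n) :=
    Primrec₂.natPair.comp (.const c) hu
  have hres : Primrec fun n => (TermR.res (.mul (.var 1) (powTerm (.var 0) n))).code :=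
    pair 6 (pair 5 (pair _ (primrec_code_powTerm _)))
  exact pair 6 (pair 0 (pair 6 (pair 1 (pair 5 (pair _ (pair 2
    (Primrec₂.natPair.comp hres (.const _))))))))

theorem undecidable_of_sentences {K V k : Type*} [Ring K] [Zero V] [Top V] [Add V] [LT V] [Ring k]
    {M : LResStructure K V k} {H : ℕ → Prop} (hH : ¬ ComputablePred H) {φ : ℕ → Formula}
    (hcode : Computable fun n => (φ n).code) (hφ : ∀ n, (φ n).IsSentence)
    (hsat : ∀ n (e : Assignment K V k), M.Satisfies e (φ n) ↔ H n) : M.Undecidable := by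
  refine fun hM => hH ((ComputablePred.computable_of_manyOneReducible
    (ManyOneReducible.mk _ hcode) hM).of_eq fun n => ⟨?_, fun hn => ?_⟩)
  · rintro ⟨ψ, hψ, -, htrue⟩
    rw [Formula.code_injective hψ] at htrue
    exact (hsat n ⟨fun _ => 0, fun _ => 0, fun _ => 0⟩).1 (htrue _)
  · exact ⟨φ n, rfl, hφ n, fun e => (hsat n e).2 hn⟩

variable {K V k : Type*} [Field K] [Zero V] [Top V] [Add V] [LT V] [Field k]
  {M : LResStructure K V k}

theorem IsTotalResidue.undecidable (h : M.IsTotalResidue) [Infinite k] : M.Undecidable := by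
  obtain ⟨H, hH, hdef⟩ := exists_arithmetical_not_computablePred
  obtain ⟨φ, hfree, hφ⟩ := exists_formula_of_pairs (hdef _ h.semiringClosed_coded_natCode)
    ![0] ![1]
  have hsat (e : Assignment K V k) :
      M.Satisfies e φ ↔ ∃ m, M.NatCode (e.toK 0, e.toK 1) m ∧ H m :=
    (hφ e).trans ⟨fun ⟨b, hb, hHb⟩ => ⟨b 0, hb 0, hHb⟩,
      fun ⟨m, hm, hHm⟩ => ⟨fun _ => m, Fin.forall_fin_one.2 hm, hHm⟩⟩
  refine undecidable_of_sentences hH (primrec_code_exCoeffEqOne φ).to_comp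
    (isSentence_exCoeffEqOne (hfree.trans (by simp [Set.insert_subset_iff])))
    fun n e => (satisfies_exCoeffEqOne_iff (S := fun t y => ∃ m, M.NatCode (t, y) m ∧ H m)
      hsat n e).trans ⟨?_, fun hn => ?_⟩
  · rintro ⟨t, y, ⟨m, hm, hHm⟩, hn⟩
    rwa [(hm.res_mul_pow_eq_one_iff n).1 hn]
  · obtain ⟨⟨t, y⟩, hty⟩ := h.isCoding_natCode.rightTotal n
    exact ⟨t, y, ⟨n, hty, hn⟩, (hty.res_mul_pow_eq_one_iff n).2 rfl⟩

end Undecidable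

end LResStructure

/-! ### Hahn series and Puiseux series -/

theorem IsRankOne.archimedean {Γ : Type*} [AddCommGroup Γ] [LinearOrder Γ]
    [IsOrderedAddMonoid Γ] (h : IsRankOne Γ) : Archimedean Γ where
  arch x g hg := by
    let H : AddSubgroup Γ :=
      { carrier := {x | ∃ n : ℕ, |x| ≤ n • g}
        zero_mem' := ⟨0, by simp⟩
        add_mem' := fun {a b} ⟨n, hn⟩ ⟨m, hm⟩ =>
          ⟨n + m, (abs_add_le a b).trans (add_nsmul g n m ▸ add_le_add hn hm)⟩
        neg_mem' := fun {a} ⟨n, hn⟩ => ⟨n, (abs_neg a).trans_le hn⟩ }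
    have hconvex : (H : Set Γ).OrdConnected := by
      refine ⟨fun a ⟨n, hn⟩ b ⟨m, hm⟩ c ⟨hac, hcb⟩ => ⟨max n m, ?_⟩⟩
      have hmono {i : ℕ} (hi : i ≤ max n m) : i • g ≤ max n m • g := nsmul_le_nsmul_left hg.le hi
      exact (abs_le_max_abs_abs hac hcb).trans
        (max_le (hn.trans (hmono (le_max_left n m))) (hm.trans (hmono (le_max_right n m))))
    have hgH : g ∈ H := ⟨1, by rw [one_nsmul, abs_of_pos hg]⟩
    have htop : H = ⊤ := (h.2 H hconvex).resolve_left fun hbot =>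
      hg.ne' ((AddSubgroup.mem_bot).1 (hbot ▸ hgH))
    obtain ⟨n, hn⟩ : x ∈ H := htop ▸ AddSubgroup.mem_top x
    exact ⟨n, (le_abs_self x).trans hn⟩

theorem exists_forall_ge_add_nsmul_pos {Γ : Type*} [AddCommGroup Γ] [LinearOrder Γ]
    [IsOrderedAddMonoid Γ] [Archimedean Γ] (a : WithTop Γ) {g : WithTop Γ} (hg : 0 < g) :
    ∃ N : ℕ, ∀ n ≥ N, 0 < a + n • g := by
  induction a with
  | top => exact ⟨0, fun n _ => by simp⟩
  | coe a =>
    induction g with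
    | top =>
      refine ⟨1, fun n hn => ?_⟩
      obtain ⟨m, rfl⟩ := Nat.exists_eq_add_of_le' hn
      simp [succ_nsmul]
    | coe g =>
      rw [WithTop.coe_pos] at hg
      obtain ⟨N, hN⟩ := exists_lt_nsmul hg (-a)
      refine ⟨N, fun n hn => ?_⟩
      rw [← WithTop.coe_nsmul, ← WithTop.coe_add, WithTop.coe_pos, ← neg_lt_iff_pos_add']
      exact hN.trans_le (nsmul_le_nsmul_left hg.le hn)

section HahnSeries

variable {Γ k : Type*} [AddCommGroup Γ] [LinearOrder Γ] [IsOrderedAddMonoid Γ] [Field k]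

theorem coeff_zero_eq_zero_of_addVal_pos {x : HahnSeries Γ k}
    (hx : 0 < HahnSeries.addVal Γ k x) : x.coeff 0 = 0 :=
  HahnSeries.coeff_eq_zero_of_lt_orderTop hx

theorem coeff_zero_C_mul (c : k) (x : HahnSeries Γ k) :
    (HahnSeries.C c * x).coeff 0 = c * x.coeff 0 := by
  rw [HahnSeries.C_mul_eq_smul, HahnSeries.coeff_smul, smul_eq_mul]

theorem addVal_ne_zero_of_coeff_zero_eq_zero {x : HahnSeries Γ k} (hx : x.coeff 0 = 0) :
    HahnSeries.addVal Γ k x ≠ 0 :=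
  fun h => HahnSeries.coeff_orderTop_ne h hx

theorem exists_mem_addVal_pos {F : Subfield (HahnSeries Γ k)}
    (hF : (HahnSeries.C : k →+* HahnSeries Γ k).range < F.toSubring) :
    ∃ x ∈ F, x ≠ 0 ∧ 0 < HahnSeries.addVal Γ k x := by
  obtain ⟨hC, b, hbF, hbC⟩ := SetLike.lt_iff_le_and_exists.1 hF
  set x := b - HahnSeries.C (b.coeff 0) with hx
  have hxF : x ∈ F := F.sub_mem hbF (hC ⟨_, rfl⟩)
  have hx0 : x ≠ 0 := fun h => hbC ⟨_, (sub_eq_zero.1 h).symm⟩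
  have hcoeff : x.coeff 0 = 0 := by simp [hx]
  rcases (addVal_ne_zero_of_coeff_zero_eq_zero hcoeff).lt_or_gt with hneg | hpos
  · refine ⟨x⁻¹, F.inv_mem hxF, inv_ne_zero hx0, ?_⟩
    have hadd : HahnSeries.addVal Γ k x + HahnSeries.addVal Γ k x⁻¹ = 0 := by
      rw [← AddValuation.map_mul, mul_inv_cancel₀ hx0, AddValuation.map_one]
    by_contra! hle
    exact (add_neg_of_neg_of_nonpos hneg hle).ne hadd
  · exact ⟨x, hxF, hx0, hpos⟩

theorem LResStructure.isTotalResidue_of_hahnSeries [Archimedean Γ] {K : Type*} [Field K]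
    (M : LResStructure K (WithTop Γ) k) (j : K →+* HahnSeries Γ k)
    (hval : ∀ x, M.val x = HahnSeries.addVal Γ k (j x)) (hres : ∀ x, M.res x = (j x).coeff 0)
    (hC : (HahnSeries.C : k →+* HahnSeries Γ k).range < j.range) : M.IsTotalResidue where
  res_add x y := by rw [hres, hres, hres, map_add, HahnSeries.coeff_add]
  res_one := by rw [hres, map_one, HahnSeries.coeff_one, if_pos rfl]
  exists_isConst c := by
    obtain ⟨a, ha⟩ := hC.le ⟨c, rfl⟩
    have hac : M.res a = c := by rw [hres, ha, HahnSeries.C_apply, HahnSeries.coeff_single_same]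
    exact ⟨a, fun x => by rw [hac, hres, hres, map_mul, ha, coeff_zero_C_mul], hac⟩
  exists_res_mul_pow_eq_zero {t} ht y := by
    rw [hval] at ht
    obtain ⟨N, hN⟩ := exists_forall_ge_add_nsmul_pos (HahnSeries.addVal Γ k (j y)) ht
    refine ⟨N, fun n hn => ?_⟩
    rw [hres, map_mul, map_pow]
    refine coeff_zero_eq_zero_of_addVal_pos ?_
    rw [AddValuation.map_mul, AddValuation.map_pow]
    exact hN n hn
  res_pow_eq_zero {t} ht n hn := by
    rw [hval] at ht
    rw [hres, map_pow]
    refine coeff_zero_eq_zero_of_addVal_pos ?_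
    rw [AddValuation.map_pow]
    exact nsmul_pos ht hn
  exists_val_pos := by
    obtain ⟨_, ⟨t, rfl⟩, ht0, ht⟩ := exists_mem_addVal_pos (F := j.fieldRange) hC
    exact ⟨t, fun h => ht0 (h ▸ map_zero j), (hval t).symm ▸ ht⟩

theorem range_C_lt_of_single_mem {R : Subring (HahnSeries Γ k)}
    (hC : (HahnSeries.C : k →+* HahnSeries Γ k).range ≤ R) {q : Γ} (hq : q ≠ 0)
    (hqR : HahnSeries.single q 1 ∈ R) : (HahnSeries.C : k →+* HahnSeries Γ k).range < R := by
  refine SetLike.lt_iff_le_and_exists.2 ⟨hC, _, hqR, ?_⟩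
  rintro ⟨c, hc⟩
  have hcoeff := congrArg (fun x => x.coeff q) hc
  simp [hq] at hcoeff

end HahnSeries

theorem C_mem_puiseux {k : Type*} [Field k] (c : k) :
    (HahnSeries.C c : HahnSeries ℚ k) ∈ puiseux k :=
  Set.mem_iUnion.2 ⟨1, HahnSeries.C c, HahnSeries.embDomainRingHom_C⟩

theorem single_mem_puiseux {k : Type*} [Field k] (q : ℚ) :
    (HahnSeries.single q 1 : HahnSeries ℚ k) ∈ puiseux k := by
  refine Set.mem_iUnion.2 ⟨⟨q.den, q.pos⟩, HahnSeries.single q.num 1, ?_⟩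
  refine HahnSeries.embDomain_single.trans ?_
  congr 2
  exact q.num_div_den

theorem mainTheorem4_general {k Γ K : Type*} [Field k] [Infinite k] [AddCommGroup Γ]
    [LinearOrder Γ] [IsOrderedAddMonoid Γ] [Archimedean Γ] [Field K]
    (M : LResStructure K (WithTop Γ) k) (j : K →+* HahnSeries Γ k)
    (hval : ∀ x, M.val x = HahnSeries.addVal Γ k (j x)) (hres : ∀ x, M.res x = (j x).coeff 0)
    (hC : (HahnSeries.C : k →+* HahnSeries Γ k).range < j.range) :
    M.Interprets arithLanguage ℕ ∧ M.Undecidable :=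
  have h := M.isTotalResidue_of_hahnSeries j hval hres hC
  ⟨LResStructure.interprets_arith h.isCoding_natCode h.semiringClosed_coded_natCode,
    h.undecidable⟩

theorem mainTheorem4 (k : Type u) [Field k] [Infinite k] :
    (∀ (Γ : Type v) [AddCommGroup Γ] [LinearOrder Γ] [IsOrderedAddMonoid Γ], IsRankOne Γ →
      (hahnRes k Γ).Interprets arithLanguage ℕ ∧ (hahnRes k Γ).Undecidable) ∧
    ((puiseuxRes k).Interprets arithLanguage ℕ ∧ (puiseuxRes k).Undecidable) := by
  refine ⟨fun Γ _ _ _ hΓ => ?_, ?_⟩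
  · have := hΓ.archimedean
    have := hΓ.1
    obtain ⟨q, hq⟩ := exists_ne (0 : Γ)
    exact mainTheorem4_general (hahnRes k Γ) (RingHom.id _) (fun _ => rfl) (fun _ => rfl)
      (range_C_lt_of_single_mem (fun x _ => ⟨x, rfl⟩) hq ⟨_, rfl⟩)
  · refine mainTheorem4_general (puiseuxRes k) (puiseux k).subtype (fun _ => rfl) (fun _ => rfl)
      (range_C_lt_of_single_mem ?_ one_ne_zero ⟨⟨_, single_mem_puiseux 1⟩, rfl⟩)
    rintro _ ⟨c, rfl⟩
    exact ⟨⟨_, C_mem_puiseux c⟩, rfl⟩
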